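/- Let $\Omega=(0,2\pi)^3$ with periodic boundary conditions, let $|\cdot|$ and $(\cdot,\cdot)$ be the norm and inner product of $L^2(\Omega)$, and let $|g|_{H^{-1}}=\sup\{(g,v): v\in H^1 \text{ periodic with zero mean},\ |\nabla v|\le1\}$. Let $c_0,c_4,c_5>0$ be constants depending only on $\Omega$ such that - $|u|^2\le c_0|\nabla u|^2$ for periodic mean-zero $u\in H^1$ and $|\nabla u|^2\le c_0|\Delta u|^2$ for periodic mean-zero $u\in H^2$; - $|(u\cdot\nabla u,\Delta u)|\le \frac{c_4}{2\nu^3}|\nabla u|^6+\frac{\nu}{2}|\Delta u|^2$ for all $\nu>0$ and all periodic, divergence-free, mean-zero $u\in H^2$; - $2|(v\cdot\nabla v,w)|\le\frac{\nu}{2}|\nabla v|^2+\frac{c_5}{\nu^3}|v|^2|\nabla w|^4$ for all $\nu>0$ and all periodic, divergence-free, mean-zero $v,w\in H^1$. Such constants exist, and for all such constants the following holds. Let $\nu>0$, let $u_0\in H^1$ be periodic, divergence-free and mean-zero, and let $f(t)\in L^2(\Omega)$, $t\ge0$, be divergence-free and mean-zero with $|f|_{L^\infty(L^2)}:=\sup_{t\ge0}|f(t)|<\infty$;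 put $|f|_{L^\infty(H^{-1})}:=\sup_{t\ge0}|f(t)|_{H^{-1}}$. For a timestep $k>0$, let $f^1,f^2,\dots\in L^2(\Omega)$ be divergence-free and mean-zero with $|f^n|\le|f|_{L^\infty(L^2)}$ and $|f^n|_{H^{-1}}\le|f|_{L^\infty(H^{-1})}$ (for example $f^n=f(nk)$), and let $u^0=u_0$ and $u^n$, $n\ge1$, be any periodic, divergence-free, mean-zero $H^2$ fields that satisfy the fully implicit Euler scheme $$\frac{u^n-u^{n-1}}{k}+u^n\cdot\nabla u^n+\nabla p^n=\nu\Delta u^n+f^n ,\qquad n\ge1,$$ almost everywhere in $\Omega$, with periodic pressures $p^n\in H^1$. Put $\tilde K_0=|u_0|^2+\frac{2c_0}{\nu^2}|f|^2_{L^\infty(H^{-1})}$. **Short times.** There is a $t_f^*>0$, independent of $k$, of the $f^n$ and of the $u^n$, with $$t_f^*\ \ge\ \frac{\nu^3}{8c_4\bigl(|\nabla u_0|^2+(2\nu^2|f|^2_{L^\infty(L^2)}/c_4)^{1/3}\bigr)^2}$$ whenever the denominator is not zero, such that the following holds. Put $$\tilde K=2|\nabla u_0|^2+2\bigl(\nu^2|f|^2_{L^\infty(L^2)}/c_4\bigr)^{1/3}+10c_0\min\bigl(\tfrac1\nu,\tfrac1{\nu^2}\bigr)|f|^2_{L^\infty(L^2)}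 .$$ If $$\tilde K\le\frac12\Bigl(\frac{\nu^3}{3c_4k}\Bigr)^{1/2},\qquad \Bigl(1+\frac{c_5}{\nu^4}\tilde K_0\tilde K\Bigr)\tilde K+\frac{|f|^2_{L^\infty(H^{-1})}}{\nu^2}\le\Bigl(\frac{\nu^3}{12c_4k}\Bigr)^{1/2},$$ $$\biggl(2|\nabla u_0|^2+\frac{(1+2^{1/3})\,\nu^{2/3}\,|f|^{2/3}_{L^\infty(L^2)}}{c_4^{1/3}}\biggr)^2\le\frac{(2^{1/3}-1)\nu^3}{2c_4k},$$ then for all $n$ with $0\le nk\le t_f^*$ $$|\nabla u^n|^2\le2|\nabla u_0|^2+\bigl(\nu^2|f|^2_{L^\infty(L^2)}/c_4\bigr)^{1/3}.$$ **Small solutions.** Put $\tilde K_1=|\nabla u_0|^2+\frac{10c_0}{\nu^2}|f|^2_{L^\infty(L^2)}$. If $$|\nabla u_0|^2+\frac{2c_0}{\nu^2}|f|^2_{L^\infty(L^2)}\le\frac{\nu^2}{2\sqrt{c_0c_4}},$$ and if $k\le c_0/\nu$, $$\tilde K_1\le\frac12\Bigl(\frac{\nu^3}{3c_4k}\Bigr)^{1/2},\qquad\Bigl(1+\frac{c_5}{\nu^4}\tilde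 K_0\tilde K_1\Bigr)\tilde K_1+\frac{|f|^2_{L^\infty(H^{-1})}}{\nu^2}\le\Bigl(\frac{\nu^3}{12c_4k}\Bigr)^{1/2},$$ then $|\nabla u^n|^2\le\tilde K_1$ for all $n\in\{0,1,2,\dots\}$. -/

import Mathlib

open MeasureTheory
open scoped ContDiff

namespace EulerNSE

noncomputable section

/-- Three-dimensional Euclidean space. -/
abbrev E3 : Type := EuclideanSpace ℝ (Fin 3)

/-- The periodic box `Ω = (0, 2π)³`. -/
def Omega : Set E3 := {x | ∀ i, x i ∈ Set.Ioo (0 : ℝ) (2 * Real.pi)}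

/-- A vector field, given by its three components. Only the values on `Ω` matter. -/
abbrev Field : Type := Fin 3 → E3 → ℝ

/-- Classical partial derivative in the direction `i`. -/
def pd (i : Fin 3) (φ : E3 → ℝ) (x : E3) : ℝ :=
  fderiv ℝ φ x (EuclideanSpace.single i (1 : ℝ))

/-- Smooth functions that are `2π`-periodic in each variable. -/
structure IsTest (φ : E3 → ℝ) : Prop where
  smooth : ContDiff ℝ ∞ φ
  periodic : ∀ (i : Fin 3) (x : E3), φ (x + EuclideanSpace.single i (2 * Real.pi)) = φ x

/-- Square integrability on `Ω`. -/
def IsL2 (g : E3 → ℝ) : Prop := MemLp g 2 (volume.restrict Omega)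

/-- `h` is the weak `i`-th partial derivative of `g` on the periodic box. Since the test functions
are periodic and need not vanish near the boundary of `Ω`, this includes the periodic boundary
condition: it says that `h` is the distributional derivative on the torus of `g`. -/
def IsWeakDeriv (i : Fin 3) (g h : E3 → ℝ) : Prop :=
  ∀ φ : E3 → ℝ, IsTest φ →
    ∫ x in Omega, g x * pd i φ x = - ∫ x in Omega, h x * φ x

/-- The periodic Sobolev space `H¹`. -/
structure IsH1 (g : E3 → ℝ) : Prop where
  memL2 : IsL2 g
  exists_deriv : ∀ i : Fin 3, ∃ h : E3 → ℝ, IsL2 h ∧ IsWeakDeriv i g h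

open Classical in
/-- A representative of the weak `i`-th partial derivative (unique almost everywhere on `Ω`) when
it exists in `L²`, and `0` otherwise. It is used only where it exists. -/
def wd (i : Fin 3) (g : E3 → ℝ) : E3 → ℝ :=
  if H : ∃ h : E3 → ℝ, IsL2 h ∧ IsWeakDeriv i g h then Classical.choose H else 0

/-- The periodic Sobolev space `H²`. -/
structure IsH2 (g : E3 → ℝ) : Prop where
  memH1 : IsH1 g
  derivH1 : ∀ i : Fin 3, IsH1 (wd i g)

/-- The weak Laplacian of a scalar function. -/
def lap (g : E3 → ℝ) (x : E3) : ℝ := ∑ i, wd i (wd i g) x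

/-- The componentwise weak Laplacian `Δu`. -/
def vlap (u : Field) : Field := fun j => lap (u j)

/-- The advection term `u·∇v`. -/
def advect (u v : Field) : Field := fun j x => ∑ i, u i x * wd i (v j) x

/-- The inner product `(u, v)` of `L²(Ω)`. -/
def l2Inner (u v : Field) : ℝ := ∫ x in Omega, ∑ j, u j x * v j x

/-- `|u|²`. -/
def l2Sq (u : Field) : ℝ := ∫ x in Omega, ∑ j, u j x ^ 2

/-- `|∇u|²`. -/
def gradSq (u : Field) : ℝ := ∫ x in Omega, ∑ i, ∑ j, wd i (u j) x ^ 2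

/-- Vanishing integral over `Ω`. -/
def MeanZero (u : Field) : Prop := ∀ j, ∫ x in Omega, u j x = 0

/-- `∇·u = 0` in the weak sense on the periodic box. -/
def DivFree (u : Field) : Prop :=
  ∀ φ : E3 → ℝ, IsTest φ → ∫ x in Omega, ∑ i, u i x * pd i φ x = 0

/-- Divergence-free mean-zero fields in `L²`. -/
structure IsSolL2 (u : Field) : Prop where
  reg : ∀ j, IsL2 (u j)
  mean : MeanZero u
  div : DivFree u

/-- Divergence-free mean-zero fields in periodic `H¹`. -/
structure IsSolH1 (u : Field) : Prop where
  reg : ∀ j, IsH1 (u j)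
  mean : MeanZero u
  div : DivFree u

/-- Divergence-free mean-zero fields in periodic `H²`. -/
structure IsSolH2 (u : Field) : Prop where
  reg : ∀ j, IsH2 (u j)
  mean : MeanZero u
  div : DivFree u

/-- `|f|_{L²}`. -/
def l2Norm (f : Field) : ℝ := Real.sqrt (l2Sq f)

/-- `|f|_{H⁻¹}`: the norm dual to `|∇·|` on mean-zero periodic `H¹` fields. -/
def hm1Norm (f : Field) : ℝ :=
  sSup {r : ℝ | ∃ v : Field, (∀ j, IsH1 (v j)) ∧ MeanZero v ∧ gradSq v ≤ 1 ∧ r = l2Inner f v}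

/-- `|f|_{L^∞(L²)} = sup_{t ≥ 0} |f(t)|_{L²}`. -/
def supL2 (f : ℝ → Field) : ℝ := sSup ((fun t => l2Norm (f t)) '' Set.Ici 0)

/-- `|f|_{L^∞(H⁻¹)} = sup_{t ≥ 0} |f(t)|_{H⁻¹}`. -/
def supHm1 (f : ℝ → Field) : ℝ := sSup ((fun t => hm1Norm (f t)) '' Set.Ici 0)

/-- A divergence-free mean-zero forcing that is bounded in `L²`, uniformly in `t ≥ 0`. -/
structure IsForcing (f : ℝ → Field) : Prop where
  sol : ∀ t, 0 ≤ t → IsSolL2 (f t)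
  bdd : BddAbove ((fun t => l2Norm (f t)) '' Set.Ici 0)

/-- Discrete forcings `f¹, f², …` for `f`: divergence-free mean-zero `L²` fields that obey the
bounds of `f` (for instance `fⁿ = f(nk)`, or averages of `f` over the time steps). -/
structure IsDiscreteForcing (f : ℝ → Field) (fn : ℕ → Field) : Prop where
  sol : ∀ n, 1 ≤ n → IsSolL2 (fn n)
  l2_le : ∀ n, 1 ≤ n → l2Norm (fn n) ≤ supL2 f
  hm1_le : ∀ n, 1 ≤ n → hm1Norm (fn n) ≤ supHm1 f

/-- The fully implicit Euler scheme
`(uⁿ − uⁿ⁻¹)/k + uⁿ·∇uⁿ + ∇p = ν Δuⁿ + fⁿ`, `∇·uⁿ = 0`, `u⁰ = u₀`: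
the equation holds almost everywhere on `Ω`, with `uⁿ` in `H²` for `n ≥ 1` and `p` in `H¹`
(`p` may depend on `n`). -/
structure IsImplicitEuler (ν k : ℝ) (fn : ℕ → Field) (u₀ : Field) (u : ℕ → Field) : Prop where
  init : u 0 = u₀
  sol : ∀ n, IsSolH2 (u (n + 1))
  step : ∀ n, ∃ p : E3 → ℝ, IsH1 p ∧ ∀ j, ∀ᵐ x ∂(volume.restrict Omega),
    (u (n + 1) j x - u n j x) / k + advect (u (n + 1)) (u (n + 1)) j x + wd j p x
      = ν * vlap (u (n + 1)) j x + fn (n + 1) j x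

/-- The constants `c₀`, `c₄`, `c₅` of the box `Ω`: `c₀` is a constant in the Poincaré inequalities,
`c₄` one in the bound of `(u·∇u, Δu)`, `c₅` one in the bound of `2 (v·∇v, w)`. They depend on `Ω`
alone; in particular the last two bounds are required for every `ν > 0`. -/
structure IsDomainConstants (c₀ c₄ c₅ : ℝ) : Prop where
  pos₀ : 0 < c₀
  pos₄ : 0 < c₄
  pos₅ : 0 < c₅
  poincare : ∀ u : Field, (∀ j, IsH1 (u j)) → MeanZero u → l2Sq u ≤ c₀ * gradSq u
  poincare' : ∀ u : Field, (∀ j, IsH2 (u j)) → MeanZero u → gradSq u ≤ c₀ * l2Sq (vlap u)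
  bound₄ : ∀ u : Field, IsSolH2 u → ∀ ν : ℝ, 0 < ν →
    |l2Inner (advect u u) (vlap u)|
      ≤ c₄ / (2 * ν ^ 3) * gradSq u ^ 3 + ν / 2 * l2Sq (vlap u)
  bound₅ : ∀ v w : Field, IsSolH1 v → IsSolH1 w → ∀ ν : ℝ, 0 < ν →
    2 * |l2Inner (advect v v) w|
      ≤ ν / 2 * gradSq v + c₅ / ν ^ 3 * l2Sq v * gradSq w ^ 2

/-- `K̃₀ = |u₀|² + (2c₀/ν²) |f|²_{L^∞(H⁻¹)}`. -/
def K0t (c₀ ν : ℝ) (u₀ : Field) (f : ℝ → Field) : ℝ :=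
  l2Sq u₀ + 2 * c₀ / ν ^ 2 * supHm1 f ^ 2

/-- `K̃ = 2|∇u₀|² + 2(ν²|f|²/c₄)^{1/3} + 10 c₀ min(1/ν, 1/ν²) |f|²`, where `|f|` is the norm of
`L^∞(L²)`. The minimum makes the timestep restrictions hold as soon as they hold with `1/ν` or
with the dimensionally consistent `1/ν²` in its place. -/
def Kt (c₀ c₄ ν : ℝ) (u₀ : Field) (f : ℝ → Field) : ℝ :=
  2 * gradSq u₀ + 2 * (ν ^ 2 * supL2 f ^ 2 / c₄) ^ (1 / 3 : ℝ)
    + 10 * c₀ * min (1 / ν) (1 / ν ^ 2) * supL2 f ^ 2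

/-- `K̃₁ = |∇u₀|² + (10c₀/ν²) |f|²_{L^∞(L²)}`. -/
def K1t (c₀ ν : ℝ) (u₀ : Field) (f : ℝ → Field) : ℝ :=
  gradSq u₀ + 10 * c₀ / ν ^ 2 * supL2 f ^ 2

/-- The two restrictions on the timestep `k` relative to a quantity `K`:
`K ≤ ½ (ν³/(3c₄k))^{1/2}` and
`(1 + (c₅/ν⁴) K̃₀ K) K + |f|²_{L^∞(H⁻¹)}/ν² ≤ (ν³/(12c₄k))^{1/2}`. -/
structure StepRestriction (c₀ c₄ c₅ ν k : ℝ) (u₀ : Field) (f : ℝ → Field) (K : ℝ) : Prop where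
  first : K ≤ 1 / 2 * Real.sqrt (ν ^ 3 / (3 * c₄ * k))
  second : (1 + c₅ / ν ^ 4 * K0t c₀ ν u₀ f * K) * K + supHm1 f ^ 2 / ν ^ 2
    ≤ Real.sqrt (ν ^ 3 / (12 * c₄ * k))

end

end EulerNSE

/-! Write a_n = |∇uⁿ|² and F = |f|_{L^∞(L²)}. Testing the scheme with Δuⁿ⁺¹ and using `bound₄` gives
a_{n+1} - a_n ≤ k (c₄ν⁻³ a_{n+1}³ - ν|Δuⁿ⁺¹|² + 2F|Δuⁿ⁺¹|). The cubic is taken at the new time, so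
this alone does not control a_{n+1}: the map y ↦ y - c₄kν⁻³y³ increases only while c₄kν⁻³y² ≤ 1/3,
and a_{n+1} might lie on the far branch.

The far branch is excluded by two further tests. With uⁿ⁺¹ one gets a uniform bound of |uⁿ|². With
uⁿ⁺¹ - uⁿ and `bound₅` one gets a bound of a_{n+1} by a_n and |uⁿ⁺¹|² that does not involve k
(`step_estimates`). The timestep restriction then puts a_{n+1} on the monotone branch
(`mul_gradSq_sq_le`), and a barrier argument works as for a differential inequality.

For short times, the force is absorbed into the viscous term and the barrier is the linear function
of time with slope the largest admissible growth rate (`short_time_bound`). For small data, the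
problem is scaled so that the threshold becomes 1 (`gradSq_le_small`). If the force is weak, the
enstrophy inequality has an invariant interval; if it is strong, the barrier is found for a
combination of enstrophy and energy (`global_bound`).

The domain constants are constructed by Fourier series: Poincaré from |k| ≥ 1, `bound₄` from Agmon's
inequality and `bound₅` from the embedding of H¹ in L⁶. The last two rest on splitting the series at
a frequency R and counting lattice points. Agmon's inequality also makes H² fields bounded, so that
the advection term is in L² and (u·∇u, u) = 0. -/

namespace EulerNSE

noncomputable section

open Filter
open scoped ComplexConjugate ENNReal Topology

/-! ### Fourier series on the periodic box -/

/-- Wave vectors. -/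
abbrev Freq : Type := Fin 3 → ℤ

/-- The volume `(2π)³` of the box. -/
def boxVol : ℝ := (2 * Real.pi) ^ 3

lemma boxVol_pos : 0 < boxVol := by unfold boxVol; positivity

lemma measurableSet_Omega : MeasurableSet Omega := by
  have : Omega = ⋂ i, (fun x : E3 => x i) ⁻¹' Set.Ioo (0 : ℝ) (2 * Real.pi) := by
    ext x; simp [Omega]
  rw [this]
  exact MeasurableSet.iInter fun i =>
    measurableSet_Ioo.preimage (EuclideanSpace.proj i).continuous.measurable

/-- The phase `k · x`. -/
def phase (k : Freq) (x : E3) : ℝ := ∑ i, (k i : ℝ) * x i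

/-- The plane wave `exp (i k · x)`. -/
def wave (k : Freq) (x : E3) : ℂ := Complex.exp (Complex.I * phase k x)

lemma norm_wave (k : Freq) (x : E3) : ‖wave k x‖ = 1 := by
  rw [wave, mul_comm]; exact Complex.norm_exp_ofReal_mul_I _

section Torus

open UnitAddTorus

attribute [local instance] instMeasureSpaceUnitAddCircle
attribute [local instance] instIsAddHaarMeasureUnitAddCircleVolume
attribute [local instance] instIsProbabilityMeasureUnitAddCircleVolume

/-- The section of the covering of the torus by `ℝ³` with values in `(0, 2π]³`. -/
def toBox (y : UnitAddTorus (Fin 3)) : E3 :=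
  WithLp.toLp 2 ((2 * Real.pi) • (measurableEquivPiIoc (fun _ : Fin 3 => (0 : ℝ)) y).1)

lemma toBox_apply (y : UnitAddTorus (Fin 3)) (i : Fin 3) :
    toBox y i = 2 * Real.pi * (AddCircle.equivIoc 1 0 (y i)).1 := rfl

lemma measurable_toBox : Measurable toBox := by
  unfold toBox
  refine (PiLp.volume_preserving_toLp (Fin 3)).measurable.comp ?_
  exact (measurableEquivPiIoc (fun _ : Fin 3 => (0 : ℝ))).measurable.subtype_val.const_smul
    (2 * Real.pi)

/-- This carries Fourier analysis on the unit torus over to the box. The map is a composition of a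
section onto the cell (0,1]³, a dilation by 2π, whose Jacobian gives the factor (2π)⁻³, and the
identification with Euclidean space. Half-open and open cells differ by a null set. -/
lemma map_toBox :
    Measure.map toBox volume = ENNReal.ofReal boxVol⁻¹ • volume.restrict Omega := by
  have h1 : Measure.map (fun y => (measurableEquivPiIoc (fun _ : Fin 3 => (0 : ℝ)) y).1) volume
      = volume.restrict {x : Fin 3 → ℝ | ∀ i, x i ∈ Set.Ioc (0 : ℝ) (0 + 1)} := by
    have := congrArg (Measure.map Subtype.val)
      (measurePreserving_equivPiIoc (fun _ : Fin 3 => (0 : ℝ))).map_eq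
    rw [Measure.map_map measurable_subtype_coe (measurableEquivPiIoc _).measurable] at this
    exact this.trans (map_comap_subtype_coe (s := {x : Fin 3 → ℝ | ∀ i, x i ∈ Set.Ioc 0 (0 + 1)})
      (MeasurableSet.univ_pi' fun i => measurableSet_Ioc) volume)
  have hc : (2 * Real.pi : ℝ) ≠ 0 := by positivity
  have h2 : Measure.map (fun x : Fin 3 → ℝ => (2 * Real.pi) • x)
      (volume.restrict {x : Fin 3 → ℝ | ∀ i, x i ∈ Set.Ioc (0 : ℝ) (0 + 1)})
      = ENNReal.ofReal boxVol⁻¹ •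
        volume.restrict (Set.univ.pi fun _ : Fin 3 => Set.Ioo (0 : ℝ) (2 * Real.pi)) := by
    have e : {x : Fin 3 → ℝ | ∀ i, x i ∈ Set.Ioc (0 : ℝ) (0 + 1)}
        = (fun x : Fin 3 → ℝ => (2 * Real.pi) • x) ⁻¹'
          (Set.univ.pi fun _ : Fin 3 => Set.Ioc (0 : ℝ) (2 * Real.pi)) := by
      ext x
      have hp : (0 : ℝ) < 2 * Real.pi := by positivity
      simp only [Set.mem_ofPred_eq, Set.mem_Ioc, zero_add, Set.mem_preimage, Set.mem_univ_pi,
        Pi.smul_apply, smul_eq_mul]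
      refine forall_congr' fun i => ?_
      rw [mul_pos_iff_of_pos_left hp, mul_le_iff_le_one_right hp]
    rw [e, ← Measure.restrict_map (measurable_const_smul _)
      (MeasurableSet.univ_pi fun i => measurableSet_Ioc), Measure.map_addHaar_smul _ hc,
      Measure.restrict_smul]
    congr 1
    · congr 1
      rw [abs_of_nonneg (by positivity)]
      simp [boxVol]
    · refine Measure.restrict_congr_set ?_
      exact Measure.univ_pi_Ioc_ae_eq_Icc.trans Measure.univ_pi_Ioo_ae_eq_Icc.symm
  have h3 : Measure.map (WithLp.toLp 2 : (Fin 3 → ℝ) → E3)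
      (volume.restrict (Set.univ.pi fun _ : Fin 3 => Set.Ioo (0 : ℝ) (2 * Real.pi)))
      = volume.restrict Omega := by
    have := (PiLp.volume_preserving_toLp (Fin 3)).restrict_preimage measurableSet_Omega
    rw [← this.map_eq]
    congr 2
    ext x; simp [Omega]
  have e : toBox = (WithLp.toLp 2 : (Fin 3 → ℝ) → E3) ∘
      (fun x : Fin 3 → ℝ => (2 * Real.pi) • x) ∘
      (fun y => (measurableEquivPiIoc (fun _ : Fin 3 => (0 : ℝ)) y).1) := rfl
  rw [e, ← Measure.map_map (PiLp.volume_preserving_toLp (Fin 3)).measurable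
    ((measurable_const_smul _).comp (measurableEquivPiIoc _).measurable.subtype_val),
    ← Measure.map_map (measurable_const_smul _) (measurableEquivPiIoc _).measurable.subtype_val,
    h1, h2, Measure.map_smul, h3]

lemma aestronglyMeasurable_map_toBox {G : Type*} [NormedAddCommGroup G] {g : E3 → G}
    (hg : AEStronglyMeasurable g (volume.restrict Omega)) :
    AEStronglyMeasurable g (Measure.map toBox volume) := by
  rw [map_toBox]; exact hg.smul_measure _

lemma integral_comp_toBox {G : Type*} [NormedAddCommGroup G] [NormedSpace ℝ G] {g : E3 → G}
    (hg : AEStronglyMeasurable g (volume.restrict Omega)) :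
    ∫ y, g (toBox y) = boxVol⁻¹ • ∫ x in Omega, g x := by
  rw [← integral_map measurable_toBox.aemeasurable (aestronglyMeasurable_map_toBox hg), map_toBox,
    integral_smul_measure, ENNReal.toReal_ofReal (inv_nonneg.2 boxVol_pos.le)]

lemma memLp_comp_toBox {g : E3 → ℝ} (hg : IsL2 g) :
    MemLp (fun y => (g (toBox y) : ℂ)) 2 (volume : Measure (UnitAddTorus (Fin 3))) := by
  have h : MemLp g 2 (Measure.map toBox volume) := by
    rw [map_toBox]; exact hg.smul_measure ENNReal.ofReal_ne_top
  exact (h.comp_of_map measurable_toBox.aemeasurable).ofReal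

lemma mFourier_eq_wave (k : Freq) (y : UnitAddTorus (Fin 3)) :
    mFourier k y = wave k (toBox y) := by
  have h : ∀ i, fourier (k i) (y i)
      = Complex.exp (Complex.I * ((k i : ℝ) * toBox y i : ℝ)) := by
    intro i
    have e : y i = (((AddCircle.equivIoc 1 0 (y i)).1 : ℝ) : UnitAddCircle) :=
      ((AddCircle.equivIoc 1 0).symm_apply_apply (y i)).symm
    rw [toBox_apply]
    conv_lhs => rw [e]
    rw [fourier_coe_apply]
    congr 1
    push_cast
    ring
  simp only [mFourier, ContinuousMap.coe_mk, h, wave, phase]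
  rw [← Complex.exp_sum]
  congr 1
  push_cast
  rw [Finset.mul_sum]

/-- Fourier coefficients on the box. -/
def fc (g : E3 → ℝ) (k : Freq) : ℂ := mFourierCoeff (fun y => (g (toBox y) : ℂ)) k

/-- Real part of a partial Fourier sum. -/
def trunc (s : Finset Freq) (g : E3 → ℝ) (x : E3) : ℝ := ∑ k ∈ s, (fc g k * wave k x).re

/-- **Parseval's identity** on the box. -/
lemma hasSum_fc_mul {g h : E3 → ℝ} (hg : IsL2 g) (hh : IsL2 h) :
    HasSum (fun k => (conj (fc g k) * fc h k).re) (boxVol⁻¹ * ∫ x in Omega, g x * h x) := by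
  have key := hasSum_prod_mFourierCoeff (memLp_comp_toBox hg).toLp (memLp_comp_toBox hh).toLp
  have e1 : ∀ {g : E3 → ℝ} (hg : IsL2 g) (k : Freq),
      mFourierCoeff ((memLp_comp_toBox hg).toLp : UnitAddTorus (Fin 3) → ℂ) k = fc g k := by
    intro g hg k
    refine integral_congr_ae ?_
    filter_upwards [(memLp_comp_toBox hg).coeFn_toLp] with y hy
    rw [hy]
  rw [funext fun k => congrArg₂ (fun a b => conj a * b) (e1 hg k) (e1 hh k)] at key
  have e2 : ∫ t, conj (((memLp_comp_toBox hg).toLp : UnitAddTorus (Fin 3) → ℂ) t) *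
      ((memLp_comp_toBox hh).toLp : UnitAddTorus (Fin 3) → ℂ) t
      = ((boxVol⁻¹ * ∫ x in Omega, g x * h x : ℝ) : ℂ) := by
    have : ∫ y, g (toBox y) * h (toBox y) = boxVol⁻¹ • ∫ x in Omega, g x * h x :=
      integral_comp_toBox (g := fun x => g x * h x) (hg.1.mul hh.1)
    rw [← smul_eq_mul, ← this, ← integral_complex_ofReal]
    refine integral_congr_ae ?_
    filter_upwards [(memLp_comp_toBox hg).coeFn_toLp, (memLp_comp_toBox hh).coeFn_toLp]
      with y hy hy'
    rw [hy, hy']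
    simp
  rw [e2] at key
  simpa using Complex.hasSum_re key

lemma hasSum_fc_sq {g : E3 → ℝ} (hg : IsL2 g) :
    HasSum (fun k => ‖fc g k‖ ^ 2) (boxVol⁻¹ * ∫ x in Omega, g x ^ 2) := by
  have := hasSum_fc_mul hg hg
  convert this using 2
  · rw [mul_comm, Complex.mul_conj, Complex.normSq_eq_norm_sq]; norm_cast
  · simp only [sq]

lemma fc_eq {g : E3 → ℝ} (hg : IsL2 g) (k : Freq) :
    fc g k = boxVol⁻¹ * ∫ x in Omega, g x * conj (wave k x) := by
  have hw : Continuous (wave k) := by unfold wave phase; fun_prop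
  have := integral_comp_toBox (g := fun x => (g x : ℂ) * conj (wave k x))
    ((Complex.continuous_ofReal.comp_aestronglyMeasurable hg.1).mul
      (Complex.continuous_conj.comp hw).aestronglyMeasurable)
  rw [Complex.real_smul] at this
  rw [← this, fc, mFourierCoeff]
  refine integral_congr_ae (Filter.Eventually.of_forall fun y => ?_)
  simp only [smul_eq_mul, mFourier_neg, mFourier_eq_wave]
  ring

/-- The mean-square error of a partial Fourier sum. -/
lemma integral_sub_trunc_sq_le {g : E3 → ℝ} (hg : IsL2 g) (s : Finset Freq) :
    ∫ x in Omega, (g x - trunc s g x) ^ 2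
      ≤ boxVol * (boxVol⁻¹ * (∫ x in Omega, g x ^ 2) - ∑ k ∈ s, ‖fc g k‖ ^ 2) := by
  set F := (memLp_comp_toBox hg).toLp with hF
  have hFc : ∀ k, inner ℂ (mFourierLp 2 k) F = fc g k := by
    intro k
    rw [← coe_mFourierBasis, ← HilbertBasis.repr_apply_apply, mFourierBasis_repr]
    refine integral_congr_ae ?_
    filter_upwards [(memLp_comp_toBox hg).coeFn_toLp] with y hy
    rw [hF, hy]
  set P := ∑ k ∈ s, fc g k • mFourierLp (d := Fin 3) 2 k with hP
  have hort := orthonormal_mFourier (d := Fin 3)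
  have hFP : inner ℂ P F = ((∑ k ∈ s, ‖fc g k‖ ^ 2 : ℝ) : ℂ) := by
    rw [hP, sum_inner]
    push_cast
    refine Finset.sum_congr rfl fun k _ => ?_
    rw [inner_smul_left, hFc, mul_comm, Complex.mul_conj, Complex.normSq_eq_norm_sq]; norm_cast
  have hPP : inner ℂ P P = ((∑ k ∈ s, ‖fc g k‖ ^ 2 : ℝ) : ℂ) := by
    rw [hP, hort.inner_sum]
    push_cast
    refine Finset.sum_congr rfl fun k _ => ?_
    rw [mul_comm, Complex.mul_conj, Complex.normSq_eq_norm_sq]; norm_cast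
  have hFF : ‖F‖ ^ 2 = boxVol⁻¹ * ∫ x in Omega, g x ^ 2 := by
    have h1 := hasSum_sq_mFourierCoeff F
    have h2 : ∀ k, mFourierCoeff (F : UnitAddTorus (Fin 3) → ℂ) k = fc g k := fun k => by
      rw [← mFourierBasis_repr, HilbertBasis.repr_apply_apply, coe_mFourierBasis, hFc]
    simp only [h2] at h1
    have h3 := h1.unique (hasSum_fc_sq hg)
    rw [← h3, ← inner_self_eq_norm_sq (𝕜 := ℂ), L2.inner_def, ← integral_re (L2.integrable_inner F F)]
    refine integral_congr_ae (Filter.Eventually.of_forall fun y => ?_)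
    simp only [inner_self_eq_norm_sq]
  have hnorm : ‖F - P‖ ^ 2
      = boxVol⁻¹ * (∫ x in Omega, g x ^ 2) - ∑ k ∈ s, ‖fc g k‖ ^ 2 := by
    rw [@norm_sub_sq ℂ, ← hFF, ← inner_conj_symm, hFP, ← @inner_self_eq_norm_sq ℂ _ _ _ _ P, hPP]
    simp only [RCLike.re_to_complex, Complex.conj_ofReal, Complex.ofReal_re]
    ring
  have htr : AEStronglyMeasurable (fun x => (g x - trunc s g x) ^ 2) (volume.restrict Omega) := by
    have : Continuous (trunc s g) := by unfold trunc wave phase; fun_prop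
    exact (hg.1.sub this.aestronglyMeasurable).pow 2
  have h1 := integral_comp_toBox htr
  rw [← hnorm, mul_comm, ← div_le_iff₀ boxVol_pos, div_eq_inv_mul, ← smul_eq_mul, ← h1,
    ← inner_self_eq_norm_sq (𝕜 := ℂ), L2.inner_def, ← integral_re (L2.integrable_inner _ _)]
  have hae : ∀ᵐ y, (F - P : Lp ℂ 2 (volume : Measure (UnitAddTorus (Fin 3)))) y
      = (g (toBox y) : ℂ) - ∑ k ∈ s, fc g k * wave k (toBox y) := by
    have hPc : ∀ᵐ y, P y = ∑ k ∈ s, (fc g k • mFourierLp (d := Fin 3) 2 k :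
        Lp ℂ 2 (volume : Measure (UnitAddTorus (Fin 3)))) y := by
      filter_upwards [Lp.coeFn_finsetSum s
        (fun k => fc g k • mFourierLp (d := Fin 3) 2 k)] with y hy
      rw [hP, hy, Finset.sum_apply]
    have hall : ∀ᵐ y, ∀ k : Freq, (fc g k • mFourierLp (d := Fin 3) 2 k :
        Lp ℂ 2 (volume : Measure (UnitAddTorus (Fin 3)))) y = fc g k * wave k (toBox y) := by
      rw [ae_all_iff]
      intro k
      filter_upwards [Lp.coeFn_smul (fc g k) (mFourierLp (d := Fin 3) 2 k),
        coeFn_mFourierLp (d := Fin 3) 2 k] with y h1 h2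
      rw [h1, Pi.smul_apply, h2, smul_eq_mul, mFourier_eq_wave]
    filter_upwards [Lp.coeFn_sub F P, (memLp_comp_toBox hg).coeFn_toLp, hPc, hall]
      with y h1 h2 h3 h4
    rw [h1, Pi.sub_apply, h3, hF, h2]
    simp only [h4]
  -- The set `s` need not be symmetric under k ↦ -k, so the partial sum may be complex. As g is
  -- real, taking the real part can only decrease the error; hence an inequality.
  have hle : ∀ᵐ y, (g (toBox y) - trunc s g (toBox y)) ^ 2
      ≤ RCLike.re (inner ℂ ((F - P : Lp ℂ 2 (volume : Measure (UnitAddTorus (Fin 3)))) y)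
          ((F - P : Lp ℂ 2 (volume : Measure (UnitAddTorus (Fin 3)))) y)) := by
    filter_upwards [hae] with y hy
    rw [inner_self_eq_norm_sq, hy]
    have : g (toBox y) - trunc s g (toBox y)
        = ((g (toBox y) : ℂ) - ∑ k ∈ s, fc g k * wave k (toBox y)).re := by
      simp [trunc]
    rw [this, sq_le_sq, abs_norm]
    exact Complex.abs_re_le_norm _
  refine integral_mono_of_nonneg (Filter.Eventually.of_forall fun y => sq_nonneg _)
    (L2.integrable_inner _ _).re hle

end Torus

/-! ### Square-integrable functions on the box -/

lemma Omega_subset_closedBall : Omega ⊆ Metric.closedBall (0 : E3) (2 * Real.pi * 3) := by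
  intro x hx
  rw [mem_closedBall_zero_iff, EuclideanSpace.norm_eq]
  have h : ∀ i, ‖x i‖ ^ 2 ≤ (2 * Real.pi) ^ 2 := fun i => by
    have := hx i
    rw [Real.norm_of_nonneg this.1.le]
    exact pow_le_pow_left₀ this.1.le this.2.le 2
  rw [Real.sqrt_le_left (by positivity), Fin.sum_univ_three]
  nlinarith [h 0, h 1, h 2, sq_nonneg (2 * Real.pi)]

instance isFiniteMeasure_restrict_Omega : IsFiniteMeasure (volume.restrict Omega) := by
  refine ⟨?_⟩
  rw [Measure.restrict_apply_univ]
  exact (measure_mono Omega_subset_closedBall).trans_lt (isCompact_closedBall _ _).measure_lt_top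

lemma isL2_of_continuous {φ : E3 → ℝ} (hφ : Continuous φ) : IsL2 φ := by
  unfold IsL2
  rw [memLp_two_iff_integrable_sq hφ.aestronglyMeasurable]
  have : IntegrableOn (fun x => φ x ^ 2) (Metric.closedBall (0 : E3) (2 * Real.pi * 3)) :=
    (hφ.pow 2).continuousOn.integrableOn_compact (isCompact_closedBall _ _)
  exact this.mono_set Omega_subset_closedBall

lemma IsL2.integrable_mul {g h : E3 → ℝ} (hg : IsL2 g) (hh : IsL2 h) :
    Integrable (fun x => g x * h x) (volume.restrict Omega) :=
  MemLp.integrable_mul hg hh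

lemma IsL2.add {g h : E3 → ℝ} (hg : IsL2 g) (hh : IsL2 h) : IsL2 (fun x => g x + h x) :=
  MemLp.add hg hh

lemma IsL2.sub {g h : E3 → ℝ} (hg : IsL2 g) (hh : IsL2 h) : IsL2 (fun x => g x - h x) :=
  MemLp.sub hg hh

lemma IsL2.const_mul {g : E3 → ℝ} (hg : IsL2 g) (c : ℝ) : IsL2 (fun x => c * g x) :=
  MemLp.const_mul hg c

lemma IsL2.sum {ι : Type*} (s : Finset ι) {g : ι → E3 → ℝ} (hg : ∀ i, IsL2 (g i)) :
    IsL2 (fun x => ∑ i ∈ s, g i x) :=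
  memLp_finsetSum s fun i _ => hg i

lemma IsL2.integrable_sq {g : E3 → ℝ} (hg : IsL2 g) :
    Integrable (fun x => g x ^ 2) (volume.restrict Omega) :=
  MemLp.integrable_sq hg

lemma IsH1.isL2_wd {g : E3 → ℝ} (hg : IsH1 g) (i : Fin 3) : IsL2 (wd i g) := by
  rw [wd, dif_pos (hg.exists_deriv i)]
  exact (Classical.choose_spec (hg.exists_deriv i)).1

lemma IsH1.isWeakDeriv_wd {g : E3 → ℝ} (hg : IsH1 g) (i : Fin 3) : IsWeakDeriv i g (wd i g) := by
  rw [wd, dif_pos (hg.exists_deriv i)]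
  exact (Classical.choose_spec (hg.exists_deriv i)).2

/-! ### Plane waves as test functions -/

lemma contDiff_phase (k : Freq) : ContDiff ℝ ∞ (phase k) := by
  unfold phase
  exact ContDiff.sum fun i _ => contDiff_const.mul (EuclideanSpace.proj (𝕜 := ℝ) i).contDiff

lemma phase_add_single (k : Freq) (i : Fin 3) (x : E3) :
    phase k (x + EuclideanSpace.single i (2 * Real.pi)) = phase k x + k i * (2 * Real.pi) := by
  simp [phase, mul_add, Finset.sum_add_distrib]

lemma hasFDerivAt_phase (k : Freq) (x : E3) :
    HasFDerivAt (phase k) (∑ i, (k i : ℝ) • (EuclideanSpace.proj i : E3 →L[ℝ] ℝ)) x := by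
  unfold phase
  exact HasFDerivAt.fun_sum fun i _ => (EuclideanSpace.proj i : E3 →L[ℝ] ℝ).hasFDerivAt.const_mul _

lemma isTest_comp_phase {θ : ℝ → ℝ} (hθ : ContDiff ℝ ∞ θ)
    (hper : ∀ (t : ℝ) (n : ℤ), θ (t + n * (2 * Real.pi)) = θ t) (k : Freq) :
    IsTest (fun x => θ (phase k x)) :=
  ⟨hθ.comp (contDiff_phase k), fun i x => by rw [phase_add_single, hper]⟩

lemma pd_comp_phase {θ : ℝ → ℝ} {θ' : ℝ} (k : Freq) (i : Fin 3) (x : E3)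
    (hθ : HasDerivAt θ θ' (phase k x)) :
    pd i (fun x => θ (phase k x)) x = θ' * k i := by
  have h := hθ.comp_hasFDerivAt x (hasFDerivAt_phase k x)
  have h' : fderiv ℝ (fun x => θ (phase k x)) x = _ := h.fderiv
  rw [pd, h']
  simp

lemma isTest_cos (k : Freq) : IsTest (fun x => Real.cos (phase k x)) :=
  isTest_comp_phase Real.contDiff_cos Real.cos_add_int_mul_two_pi k

lemma isTest_sin (k : Freq) : IsTest (fun x => Real.sin (phase k x)) :=
  isTest_comp_phase Real.contDiff_sin Real.sin_add_int_mul_two_pi k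

lemma pd_cos (k : Freq) (i : Fin 3) (x : E3) :
    pd i (fun x => Real.cos (phase k x)) x = -Real.sin (phase k x) * k i :=
  pd_comp_phase k i x (Real.hasDerivAt_cos _)

lemma pd_sin (k : Freq) (i : Fin 3) (x : E3) :
    pd i (fun x => Real.sin (phase k x)) x = Real.cos (phase k x) * k i :=
  pd_comp_phase k i x (Real.hasDerivAt_sin _)

lemma isL2_cos (k : Freq) : IsL2 (fun x => Real.cos (phase k x)) :=
  isL2_of_continuous (isTest_cos k).smooth.continuous

lemma isL2_sin (k : Freq) : IsL2 (fun x => Real.sin (phase k x)) :=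
  isL2_of_continuous (isTest_sin k).smooth.continuous

/-- Weak derivatives and incompressibility are defined with real test functions; this form reduces a
complex coefficient to the two real tests cos(k·x) and sin(k·x). -/
lemma fc_eq_cos_sin {g : E3 → ℝ} (hg : IsL2 g) (k : Freq) :
    fc g k = boxVol⁻¹ * ((∫ x in Omega, g x * Real.cos (phase k x) : ℝ)
      - Complex.I * (∫ x in Omega, g x * Real.sin (phase k x) : ℝ)) := by
  rw [fc_eq hg]
  congr 1
  rw [← integral_complex_ofReal, ← integral_complex_ofReal, ← integral_const_mul,
    ← integral_sub (hg.integrable_mul (isL2_cos k)).ofReal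
      ((hg.integrable_mul (isL2_sin k)).ofReal.const_mul _)]
  refine integral_congr_ae (Eventually.of_forall fun x => ?_)
  simp only [wave, ← Complex.exp_conj, map_mul, Complex.conj_I, Complex.conj_ofReal]
  rw [neg_mul, mul_comm Complex.I, ← neg_mul, Complex.exp_mul_I, Complex.cos_neg, Complex.sin_neg]
  push_cast
  ring

lemma fc_sub {g h : E3 → ℝ} (hg : IsL2 g) (hh : IsL2 h) (k : Freq) :
    fc (fun x => g x - h x) k = fc g k - fc h k := by
  rw [fc_eq_cos_sin hg, fc_eq_cos_sin hh, fc_eq_cos_sin (hg.sub hh)]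
  simp only [sub_mul]
  rw [integral_sub (hg.integrable_mul (isL2_cos k)) (hh.integrable_mul (isL2_cos k)),
    integral_sub (hg.integrable_mul (isL2_sin k)) (hh.integrable_mul (isL2_sin k))]
  push_cast
  ring

lemma fc_sum {ι : Type*} (s : Finset ι) {g : ι → E3 → ℝ} (hg : ∀ i, IsL2 (g i)) (k : Freq) :
    fc (fun x => ∑ i ∈ s, g i x) k = ∑ i ∈ s, fc (g i) k := by
  rw [fc_eq_cos_sin (IsL2.sum s hg)]
  simp only [Finset.sum_mul, fun i => fc_eq_cos_sin (hg i) k]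
  rw [integral_finsetSum _ fun i _ => (hg i).integrable_mul (isL2_cos k),
    integral_finsetSum _ fun i _ => (hg i).integrable_mul (isL2_sin k), ← Finset.mul_sum,
    Finset.sum_sub_distrib, ← Finset.mul_sum]
  push_cast
  rfl

/-- Fourier coefficients of weak derivatives. -/
lemma fc_of_isWeakDeriv {i : Fin 3} {g h : E3 → ℝ} (hg : IsL2 g) (hh : IsL2 h)
    (H : IsWeakDeriv i g h) (k : Freq) : fc h k = Complex.I * k i * fc g k := by
  have h1 := H _ (isTest_cos k)
  have h2 := H _ (isTest_sin k)
  simp only [pd_cos, pd_sin] at h1 h2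
  have e1 : ∫ x in Omega, h x * Real.cos (phase k x)
      = k i * ∫ x in Omega, g x * Real.sin (phase k x) := by
    rw [← neg_eq_iff_eq_neg] at h1
    rw [← h1, ← integral_neg, ← integral_const_mul]
    congr 1; ext x; ring
  have e2 : ∫ x in Omega, h x * Real.sin (phase k x)
      = -(k i * ∫ x in Omega, g x * Real.cos (phase k x)) := by
    rw [← neg_eq_iff_eq_neg] at h2
    rw [← h2, ← integral_const_mul]
    congr 2; ext x; ring
  rw [fc_eq_cos_sin hg, fc_eq_cos_sin hh, e1, e2]
  push_cast
  linear_combination ((boxVol : ℂ)⁻¹ * k i *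
    (∫ x in Omega, g x * Real.sin (phase k x) : ℝ)) * Complex.I_sq

lemma fc_wd {g : E3 → ℝ} (hg : IsH1 g) (i : Fin 3) (k : Freq) :
    fc (wd i g) k = Complex.I * k i * fc g k :=
  fc_of_isWeakDeriv hg.memL2 (hg.isL2_wd i) (hg.isWeakDeriv_wd i) k

lemma isL2_lap {g : E3 → ℝ} (hg : IsH2 g) : IsL2 (lap g) :=
  IsL2.sum Finset.univ fun i => (hg.derivH1 i).isL2_wd i

lemma fc_lap {g : E3 → ℝ} (hg : IsH2 g) (k : Freq) :
    fc (lap g) k = -(∑ i, (k i : ℝ) ^ 2 : ℝ) * fc g k := by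
  have : fc (lap g) k = ∑ i, fc (wd i (wd i g)) k :=
    fc_sum Finset.univ (fun i => (hg.derivH1 i).isL2_wd i) k
  rw [this]
  simp only [fun i => fc_wd (hg.derivH1 i) i k, fun i => fc_wd hg.memH1 i k]
  push_cast
  rw [neg_mul, Finset.sum_mul, ← Finset.sum_neg_distrib]
  refine Finset.sum_congr rfl fun i _ => ?_
  linear_combination ((k i : ℂ) ^ 2 * fc g k) * Complex.I_sq

lemma fc_zero_of_integral_eq_zero {g : E3 → ℝ} (hg : IsL2 g) (h : ∫ x in Omega, g x = 0) :
    fc g 0 = 0 := by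
  rw [fc_eq_cos_sin hg]
  simp [phase, h]

/-- The Fourier form of incompressibility. -/
lemma sum_mul_fc_of_divFree {u : Field} (hu : ∀ j, IsL2 (u j)) (hd : DivFree u) (k : Freq) :
    ∑ i, (k i : ℂ) * fc (u i) k = 0 := by
  have h1 := hd _ (isTest_cos k)
  have h2 := hd _ (isTest_sin k)
  simp only [pd_cos, pd_sin] at h1 h2
  have e1 : ∑ i, (k i : ℝ) * ∫ x in Omega, u i x * Real.sin (phase k x) = 0 := by
    rw [← neg_eq_zero, ← h1, integral_finsetSum, ← Finset.sum_neg_distrib]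
    · refine Finset.sum_congr rfl fun i _ => ?_
      rw [← integral_const_mul, ← integral_neg]
      congr 1; ext x; ring
    · intro i _
      convert ((hu i).integrable_mul (isL2_sin k)).const_mul (-(k i : ℝ)) using 2
      ring
  have e2 : ∑ i, (k i : ℝ) * ∫ x in Omega, u i x * Real.cos (phase k x) = 0 := by
    rw [← h2, integral_finsetSum]
    · refine Finset.sum_congr rfl fun i _ => ?_
      rw [← integral_const_mul]
      congr 1; ext x; ring
    · intro i _
      convert ((hu i).integrable_mul (isL2_cos k)).const_mul (k i : ℝ) using 2
      ring
  have : ∑ i, (k i : ℂ) * fc (u i) k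
      = boxVol⁻¹ * ((∑ i, (k i : ℝ) * ∫ x in Omega, u i x * Real.cos (phase k x) : ℝ)
        - Complex.I * (∑ i, (k i : ℝ) * ∫ x in Omega, u i x * Real.sin (phase k x) : ℝ)) := by
    simp only [fun i => fc_eq_cos_sin (hu i) k]
    push_cast
    rw [Finset.mul_sum, ← Finset.sum_sub_distrib, Finset.mul_sum]
    refine Finset.sum_congr rfl fun i _ => ?_
    ring
  rw [this, e1, e2]
  simp

/-- Square-integrable functions on the box are determined by their Fourier coefficients. -/
lemma ae_eq_of_fc_eq {g h : E3 → ℝ} (hg : IsL2 g) (hh : IsL2 h) (H : ∀ k, fc g k = fc h k) :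
    ∀ᵐ x ∂(volume.restrict Omega), g x = h x := by
  have h1 := hasSum_fc_sq (hg.sub hh)
  simp only [fc_sub hg hh, H, sub_self, norm_zero, ne_eq, OfNat.ofNat_ne_zero, not_false_eq_true,
    zero_pow] at h1
  have h2 : ∫ x in Omega, (g x - h x) ^ 2 = 0 := by
    have := hasSum_zero.unique h1
    simpa [boxVol_pos.ne'] using this.symm
  rw [integral_eq_zero_iff_of_nonneg (fun x => sq_nonneg _) (hg.sub hh).integrable_sq] at h2
  filter_upwards [h2] with x hx
  simpa [sub_eq_zero] using hx

/-! ### Partial Fourier sums -/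

lemma re_mul_wave (c : ℂ) (k : Freq) (x : E3) :
    (c * wave k x).re = c.re * Real.cos (phase k x) - c.im * Real.sin (phase k x) := by
  rw [Complex.mul_re, wave, mul_comm Complex.I, Complex.exp_ofReal_mul_I_re, Complex.exp_ofReal_mul_I_im]

lemma IsTest.const_mul {φ : E3 → ℝ} (hφ : IsTest φ) (c : ℝ) : IsTest (fun x => c * φ x) :=
  ⟨contDiff_const.mul hφ.smooth, fun i x => by rw [hφ.periodic]⟩

lemma IsTest.sub {φ ψ : E3 → ℝ} (hφ : IsTest φ) (hψ : IsTest ψ) : IsTest (fun x => φ x - ψ x) :=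
  ⟨hφ.smooth.sub hψ.smooth, fun i x => by rw [hφ.periodic, hψ.periodic]⟩

lemma IsTest.sum {ι : Type*} {s : Finset ι} {φ : ι → E3 → ℝ} (hφ : ∀ i ∈ s, IsTest (φ i)) :
    IsTest (fun x => ∑ i ∈ s, φ i x) :=
  ⟨ContDiff.sum fun i hi => (hφ i hi).smooth,
    fun j x => Finset.sum_congr rfl fun i hi => (hφ i hi).periodic j x⟩

lemma IsTest.pow {φ : E3 → ℝ} (hφ : IsTest φ) (n : ℕ) : IsTest (fun x => φ x ^ n) :=
  ⟨hφ.smooth.pow n, fun i x => by rw [hφ.periodic]⟩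

lemma isTest_trunc (s : Finset Freq) (g : E3 → ℝ) : IsTest (trunc s g) := by
  unfold trunc
  simp only [re_mul_wave]
  exact IsTest.sum fun k _ => ((isTest_cos k).const_mul _).sub ((isTest_sin k).const_mul _)

/-- Differentiation is diagonal in Fourier variables and so commutes with truncation. Hence
truncations are smooth approximations whose gradients converge in L² as well. -/
lemma pd_trunc {i : Fin 3} (s : Finset Freq) {g : E3 → ℝ} (hg : IsH1 g) (x : E3) :
    pd i (trunc s g) x = trunc s (wd i g) x := by
  have hd : ∀ {φ : E3 → ℝ}, IsTest φ → DifferentiableAt ℝ φ x := fun h =>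
    (h.smooth.differentiable (by simp)).differentiableAt
  have e : trunc s g = fun x => ∑ k ∈ s,
      ((fc g k).re * Real.cos (phase k x) - (fc g k).im * Real.sin (phase k x)) := by
    ext x; simp only [trunc, re_mul_wave]
  rw [e, pd, fderiv_fun_sum fun k _ =>
    hd (((isTest_cos k).const_mul _).sub ((isTest_sin k).const_mul _)),
    sum_apply, trunc]
  refine Finset.sum_congr rfl fun k _ => ?_
  rw [fderiv_fun_sub (hd ((isTest_cos k).const_mul _)) (hd ((isTest_sin k).const_mul _)),
    fderiv_const_mul (hd (isTest_cos k)), fderiv_const_mul (hd (isTest_sin k)), re_mul_wave,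
    fc_wd hg]
  have h1 := pd_cos k i x
  have h2 := pd_sin k i x
  rw [pd] at h1 h2
  simp only [sub_apply, smul_apply, h1, h2, smul_eq_mul]
  have h3 : (Complex.I * k i * fc g k).re = -(k i * (fc g k).im) := by simp
  have h4 : (Complex.I * k i * fc g k).im = k i * (fc g k).re := by simp
  rw [h3, h4]
  ring

lemma abs_trunc_le (s : Finset Freq) (g : E3 → ℝ) (x : E3) :
    |trunc s g x| ≤ ∑ k ∈ s, ‖fc g k‖ := by
  refine (Finset.abs_sum_le_sum_abs _ _).trans (Finset.sum_le_sum fun k _ => ?_)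
  refine (Complex.abs_re_le_norm _).trans ?_
  rw [norm_mul, norm_wave, mul_one]

lemma isL2_trunc (s : Finset Freq) (g : E3 → ℝ) : IsL2 (trunc s g) :=
  isL2_of_continuous (isTest_trunc s g).smooth.continuous

lemma tendsto_integral_sub_trunc_sq {g : E3 → ℝ} (hg : IsL2 g) :
    Tendsto (fun s : Finset Freq => ∫ x in Omega, (g x - trunc s g x) ^ 2) atTop (𝓝 0) := by
  have h : Tendsto (fun s : Finset Freq =>
      boxVol * (boxVol⁻¹ * (∫ x in Omega, g x ^ 2) - ∑ k ∈ s, ‖fc g k‖ ^ 2)) atTop (𝓝 0) := by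
    have := ((tendsto_const_nhds (x := boxVol⁻¹ * ∫ x in Omega, g x ^ 2)).sub
      (hasSum_fc_sq hg)).const_mul boxVol
    simpa using this
  exact squeeze_zero (fun s => integral_nonneg fun x => sq_nonneg _)
    (fun s => integral_sub_trunc_sq_le hg s) h

/-- A function whose Fourier coefficients have absolute sums at most `A` is bounded by `A`. -/
lemma ae_abs_le_of_sum_norm_fc_le {g : E3 → ℝ} (hg : IsL2 g) {A : ℝ}
    (hA : ∀ s : Finset Freq, ∑ k ∈ s, ‖fc g k‖ ≤ A) :
    ∀ᵐ x ∂(volume.restrict Omega), |g x| ≤ A := by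
  have hmeas : AEStronglyMeasurable (fun x => max (|g x| - A) 0 ^ 2) (volume.restrict Omega) := by
    have : Continuous fun t : ℝ => max (|t| - A) 0 ^ 2 := by fun_prop
    exact this.comp_aestronglyMeasurable hg.1
  -- Every truncation is bounded by A, so the excess of |g| over A is at most the truncation error,
  -- which tends to 0 in L².
  have hle : ∀ s x, max (|g x| - A) 0 ^ 2 ≤ (g x - trunc s g x) ^ 2 := by
    intro s x
    rw [sq_le_sq]
    rw [abs_of_nonneg (le_max_right _ _)]
    refine max_le ?_ (abs_nonneg _)
    have h1 := (abs_trunc_le s g x).trans (hA s)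
    have h2 := abs_sub_abs_le_abs_sub (g x) (trunc s g x)
    linarith
  have hint : Integrable (fun x => max (|g x| - A) 0 ^ 2) (volume.restrict Omega) := by
    refine ((hg.sub (isL2_trunc ∅ g)).integrable_sq).mono' hmeas (Eventually.of_forall fun x => ?_)
    rw [Real.norm_of_nonneg (sq_nonneg _)]
    exact hle ∅ x
  have h0 : ∫ x in Omega, max (|g x| - A) 0 ^ 2 = 0 := by
    refine le_antisymm ?_ (integral_nonneg fun x => sq_nonneg _)
    refine ge_of_tendsto' (tendsto_integral_sub_trunc_sq hg) fun s => ?_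
    exact integral_mono hint (hg.sub (isL2_trunc s g)).integrable_sq (hle s)
  rw [integral_eq_zero_iff_of_nonneg (fun x => sq_nonneg _) hint] at h0
  filter_upwards [h0] with x hx
  have : max (|g x| - A) 0 = 0 := by simpa using hx
  have := le_max_left (|g x| - A) 0
  linarith

/-! ### Integral identities and inequalities in `L²` -/

lemma l2Inner_eq_sum {u v : Field} (hu : ∀ j, IsL2 (u j)) (hv : ∀ j, IsL2 (v j)) :
    l2Inner u v = ∑ j, ∫ x in Omega, u j x * v j x :=
  integral_finsetSum _ fun j _ => (hu j).integrable_mul (hv j)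

lemma l2Sq_eq_l2Inner (u : Field) : l2Sq u = l2Inner u u := by
  simp only [l2Sq, l2Inner, sq]

lemma l2Sq_nonneg (u : Field) : 0 ≤ l2Sq u :=
  integral_nonneg fun _ => Finset.sum_nonneg fun _ _ => sq_nonneg _

lemma gradSq_nonneg (u : Field) : 0 ≤ gradSq u :=
  integral_nonneg fun _ => Finset.sum_nonneg fun _ _ => Finset.sum_nonneg fun _ _ => sq_nonneg _

lemma l2Inner_sub_left {u v w : Field} (hu : ∀ j, IsL2 (u j)) (hv : ∀ j, IsL2 (v j))
    (hw : ∀ j, IsL2 (w j)) :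
    l2Inner (fun j x => u j x - v j x) w = l2Inner u w - l2Inner v w := by
  rw [l2Inner_eq_sum (fun j => (hu j).sub (hv j)) hw, l2Inner_eq_sum hu hw, l2Inner_eq_sum hv hw,
    ← Finset.sum_sub_distrib]
  refine Finset.sum_congr rfl fun j _ => ?_
  rw [← integral_sub ((hu j).integrable_mul (hw j)) ((hv j).integrable_mul (hw j))]
  simp only [sub_mul]

lemma l2Inner_comm (u v : Field) : l2Inner u v = l2Inner v u := by
  simp only [l2Inner, mul_comm]

/-- The quadratic polynomial t ↦ ∫ (t g + h)² is nonnegative, so its discriminant is not positive.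
-/
lemma sq_integral_mul_le {g h : E3 → ℝ} (hg : IsL2 g) (hh : IsL2 h) :
    (∫ x in Omega, g x * h x) ^ 2 ≤ (∫ x in Omega, g x ^ 2) * ∫ x in Omega, h x ^ 2 := by
  have key : ∀ t : ℝ, 0 ≤ (∫ x in Omega, g x ^ 2) * (t * t)
      + (2 * ∫ x in Omega, g x * h x) * t + ∫ x in Omega, h x ^ 2 := by
    intro t
    have h0 : 0 ≤ ∫ x in Omega, (t * g x + h x) ^ 2 := integral_nonneg fun x => sq_nonneg _
    have e : ∫ x in Omega, (t * g x + h x) ^ 2 = (t * t) * (∫ x in Omega, g x ^ 2)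
        + (2 * t) * (∫ x in Omega, g x * h x) + ∫ x in Omega, h x ^ 2 := by
      have h1 : Integrable (fun x => (t * t) * g x ^ 2 + (2 * t) * (g x * h x))
          (volume.restrict Omega) :=
        (hg.integrable_sq.const_mul _).add ((hg.integrable_mul hh).const_mul _)
      rw [← integral_const_mul, ← integral_const_mul, ← integral_add
        (hg.integrable_sq.const_mul _) ((hg.integrable_mul hh).const_mul _),
        ← integral_add h1 hh.integrable_sq]
      congr 1; ext x; ring
    linarith
  have := discrim_le_zero key
  rw [discrim] at this
  nlinarith

lemma sq_l2Inner_le {u v : Field} (hu : ∀ j, IsL2 (u j)) (hv : ∀ j, IsL2 (v j)) :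
    l2Inner u v ^ 2 ≤ l2Sq u * l2Sq v := by
  rw [l2Sq_eq_l2Inner u, l2Sq_eq_l2Inner v, l2Inner_eq_sum hu hv, l2Inner_eq_sum hu hu,
    l2Inner_eq_sum hv hv]
  refine Finset.sum_sq_le_sum_mul_sum_of_sq_le_mul _ (fun j _ => ?_) (fun j _ => ?_) fun j _ => ?_
  · exact integral_nonneg fun x => mul_self_nonneg _
  · exact integral_nonneg fun x => mul_self_nonneg _
  · simpa only [sq] using sq_integral_mul_le (hu j) (hv j)

lemma abs_l2Inner_le {u v : Field} (hu : ∀ j, IsL2 (u j)) (hv : ∀ j, IsL2 (v j)) :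
    |l2Inner u v| ≤ Real.sqrt (l2Sq u) * Real.sqrt (l2Sq v) := by
  rw [← Real.sqrt_mul (l2Sq_nonneg u)]
  exact Real.abs_le_sqrt (sq_l2Inner_le hu hv)

/-! ### Linearity of the weak derivative -/

lemma IsWeakDeriv.sub {i : Fin 3} {g h g' h' : E3 → ℝ} (hg : IsL2 g) (hh : IsL2 h)
    (hg' : IsL2 g') (hh' : IsL2 h') (H : IsWeakDeriv i g g') (H' : IsWeakDeriv i h h') :
    IsWeakDeriv i (fun x => g x - h x) (fun x => g' x - h' x) := by
  intro φ hφ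
  have h1 : IsL2 φ := isL2_of_continuous hφ.smooth.continuous
  have h2 : IsL2 (pd i φ) := by
    refine isL2_of_continuous ?_
    have := hφ.smooth.continuous_fderiv (by simp)
    exact this.clm_apply continuous_const
  simp only [sub_mul]
  rw [integral_sub (hg.integrable_mul h2) (hh.integrable_mul h2),
    integral_sub (hg'.integrable_mul h1) (hh'.integrable_mul h1), H φ hφ, H' φ hφ]
  ring

lemma IsWeakDeriv.const_mul {i : Fin 3} {g g' : E3 → ℝ} (H : IsWeakDeriv i g g') (c : ℝ) :
    IsWeakDeriv i (fun x => c * g x) (fun x => c * g' x) := by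
  intro φ hφ
  simp only [mul_assoc]
  rw [integral_const_mul, integral_const_mul, H φ hφ]
  ring

lemma IsH1.sub {g h : E3 → ℝ} (hg : IsH1 g) (hh : IsH1 h) : IsH1 (fun x => g x - h x) :=
  ⟨hg.memL2.sub hh.memL2, fun i => ⟨_, (hg.isL2_wd i).sub (hh.isL2_wd i),
    (hg.isWeakDeriv_wd i).sub hg.memL2 hh.memL2 (hg.isL2_wd i) (hh.isL2_wd i)
      (hh.isWeakDeriv_wd i)⟩⟩

lemma IsH1.const_mul {g : E3 → ℝ} (hg : IsH1 g) (c : ℝ) : IsH1 (fun x => c * g x) :=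
  ⟨hg.memL2.const_mul c, fun i => ⟨_, (hg.isL2_wd i).const_mul c,
    (hg.isWeakDeriv_wd i).const_mul c⟩⟩

/-- Since `wd` is a chosen representative, its algebra holds only almost everywhere. All weak
derivatives of g share the coefficients i k_i ĝ(k), hence agree. -/
lemma IsH1.wd_ae_eq {i : Fin 3} {g h : E3 → ℝ} (hg : IsH1 g) (hh : IsL2 h)
    (H : IsWeakDeriv i g h) : ∀ᵐ x ∂(volume.restrict Omega), wd i g x = h x :=
  ae_eq_of_fc_eq (hg.isL2_wd i) hh fun k => by
    rw [fc_wd hg, fc_of_isWeakDeriv hg.memL2 hh H]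

lemma wd_sub_ae {g h : E3 → ℝ} (hg : IsH1 g) (hh : IsH1 h) (i : Fin 3) :
    ∀ᵐ x ∂(volume.restrict Omega), wd i (fun x => g x - h x) x = wd i g x - wd i h x :=
  (hg.sub hh).wd_ae_eq ((hg.isL2_wd i).sub (hh.isL2_wd i))
    ((hg.isWeakDeriv_wd i).sub hg.memL2 hh.memL2 (hg.isL2_wd i) (hh.isL2_wd i)
      (hh.isWeakDeriv_wd i))

lemma wd_const_mul_ae {g : E3 → ℝ} (hg : IsH1 g) (c : ℝ) (i : Fin 3) :
    ∀ᵐ x ∂(volume.restrict Omega), wd i (fun x => c * g x) x = c * wd i g x :=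
  (hg.const_mul c).wd_ae_eq ((hg.isL2_wd i).const_mul c) ((hg.isWeakDeriv_wd i).const_mul c)

/-- `(∇u, ∇v)`. -/
def gradInner (u v : Field) : ℝ := ∫ x in Omega, ∑ i, ∑ j, wd i (u j) x * wd i (v j) x

lemma integrable_gradInner {u v : Field} (hu : ∀ j, IsH1 (u j)) (hv : ∀ j, IsH1 (v j)) :
    Integrable (fun x => ∑ i, ∑ j, wd i (u j) x * wd i (v j) x) (volume.restrict Omega) :=
  integrable_finsetSum _ fun i _ => integrable_finsetSum _ fun j _ =>
    ((hu j).isL2_wd i).integrable_mul ((hv j).isL2_wd i)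

lemma gradInner_eq_sum {u v : Field} (hu : ∀ j, IsH1 (u j)) (hv : ∀ j, IsH1 (v j)) :
    gradInner u v = ∑ i, ∑ j, ∫ x in Omega, wd i (u j) x * wd i (v j) x := by
  rw [gradInner, integral_finsetSum _ fun i _ => integrable_finsetSum _ fun j _ =>
    ((hu j).isL2_wd i).integrable_mul ((hv j).isL2_wd i)]
  refine Finset.sum_congr rfl fun i _ => ?_
  rw [integral_finsetSum _ fun j _ => ((hu j).isL2_wd i).integrable_mul ((hv j).isL2_wd i)]

lemma gradSq_eq_gradInner (u : Field) : gradSq u = gradInner u u := by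
  simp only [gradSq, gradInner, sq]

lemma gradSq_sub {u v : Field} (hu : ∀ j, IsH1 (u j)) (hv : ∀ j, IsH1 (v j)) :
    gradSq (fun j x => u j x - v j x) = gradSq u - 2 * gradInner v u + gradSq v := by
  have h1 : Integrable (fun x => (∑ i, ∑ j, wd i (u j) x * wd i (u j) x)
      - 2 * ∑ i, ∑ j, wd i (v j) x * wd i (u j) x) (volume.restrict Omega) :=
    (integrable_gradInner hu hu).sub ((integrable_gradInner hv hu).const_mul 2)
  rw [gradSq_eq_gradInner u, gradSq_eq_gradInner v, gradInner, gradInner, gradInner,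
    ← integral_const_mul, ← integral_sub (integrable_gradInner hu hu)
      ((integrable_gradInner hv hu).const_mul 2),
    ← integral_add h1 (integrable_gradInner hv hv), gradSq]
  refine integral_congr_ae ?_
  have hall : ∀ᵐ x ∂(volume.restrict Omega), ∀ i j,
      wd i (fun x => u j x - v j x) x = wd i (u j) x - wd i (v j) x := by
    rw [ae_all_iff]; intro i
    rw [ae_all_iff]; intro j
    exact wd_sub_ae (hu j) (hv j) i
  filter_upwards [hall] with x hx
  simp only [hx, Finset.mul_sum]
  rw [← Finset.sum_sub_distrib, ← Finset.sum_add_distrib]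
  refine Finset.sum_congr rfl fun i _ => ?_
  rw [← Finset.sum_sub_distrib, ← Finset.sum_add_distrib]
  refine Finset.sum_congr rfl fun j _ => ?_
  ring

lemma gradSq_const_mul {u : Field} (hu : ∀ j, IsH1 (u j)) (c : ℝ) :
    gradSq (fun j x => c * u j x) = c ^ 2 * gradSq u := by
  rw [gradSq, gradSq, ← integral_const_mul]
  refine integral_congr_ae ?_
  have hall : ∀ᵐ x ∂(volume.restrict Omega), ∀ i j,
      wd i (fun x => c * u j x) x = c * wd i (u j) x := by
    rw [ae_all_iff]; intro i
    rw [ae_all_iff]; intro j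
    exact wd_const_mul_ae (hu j) c i
  filter_upwards [hall] with x hx
  simp only [hx, mul_pow, Finset.mul_sum]

/-- Green's identity on the periodic box. -/
lemma integral_mul_lap {g h : E3 → ℝ} (hg : IsH1 g) (hh : IsH2 h) :
    ∫ x in Omega, g x * lap h x = -∑ i, ∫ x in Omega, wd i g x * wd i h x := by
  have h1 := hasSum_fc_mul hg.memL2 (isL2_lap hh)
  have h2 : HasSum (fun k => ∑ i, (conj (fc (wd i g) k) * fc (wd i h) k).re)
      (∑ i, boxVol⁻¹ * ∫ x in Omega, wd i g x * wd i h x) :=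
    hasSum_sum fun i _ => hasSum_fc_mul (hg.isL2_wd i) (hh.memH1.isL2_wd i)
  have h3 : boxVol⁻¹ * ∫ x in Omega, g x * lap h x
      = -∑ i, boxVol⁻¹ * ∫ x in Omega, wd i g x * wd i h x := by
    refine h1.unique ?_
    -- Both sides have the same Parseval series, because |k|² is the sum of the k_i².
    refine h2.neg.congr_fun fun k => ?_
    rw [fc_lap hh, ← Complex.re_sum, ← Complex.neg_re]
    congr 1
    simp only [fc_wd hg, fc_wd hh.memH1, map_mul, Complex.conj_I, map_intCast]
    push_cast
    rw [neg_mul, Finset.sum_mul, mul_neg, neg_inj, Finset.mul_sum]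
    refine Finset.sum_congr rfl fun i _ => ?_
    linear_combination (conj (fc g k) * fc h k * (k i : ℂ) ^ 2) * Complex.I_sq
  rw [← Finset.mul_sum, ← mul_neg] at h3
  exact mul_left_cancel₀ (inv_ne_zero boxVol_pos.ne') h3

lemma l2Inner_vlap {u v : Field} (hu : ∀ j, IsH1 (u j)) (hv : ∀ j, IsH2 (v j)) :
    l2Inner u (vlap v) = -gradInner u v := by
  rw [l2Inner_eq_sum (v := vlap v) (fun j => (hu j).memL2) (fun j => isL2_lap (hv j)),
    gradInner_eq_sum hu (fun j => (hv j).memH1), Finset.sum_comm, ← Finset.sum_neg_distrib]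
  exact Finset.sum_congr rfl fun j _ => integral_mul_lap (hu j) (hv j)

/-- Gradients are orthogonal to divergence-free fields. -/
lemma l2Inner_grad_eq_zero {p : E3 → ℝ} (hp : IsH1 p) {w : Field}
    (hw : ∀ j, IsL2 (w j)) (hdiv : ∀ k : Freq, ∑ i, (k i : ℂ) * fc (w i) k = 0) :
    l2Inner (fun i => wd i p) w = 0 := by
  rw [l2Inner_eq_sum (fun i => hp.isL2_wd i) hw]
  have h2 : HasSum (fun k => ∑ i, (conj (fc (wd i p) k) * fc (w i) k).re)
      (∑ i, boxVol⁻¹ * ∫ x in Omega, wd i p x * w i x) :=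
    hasSum_sum fun i _ => hasSum_fc_mul (hp.isL2_wd i) (hw i)
  have h3 : ∀ k : Freq, ∑ i, (conj (fc (wd i p) k) * fc (w i) k).re = 0 := by
    intro k
    rw [← Complex.re_sum]
    have : ∑ i, conj (fc (wd i p) k) * fc (w i) k
        = -Complex.I * conj (fc p k) * ∑ i, (k i : ℂ) * fc (w i) k := by
      rw [Finset.mul_sum]
      refine Finset.sum_congr rfl fun i _ => ?_
      rw [fc_wd hp]
      simp only [map_mul, Complex.conj_I, map_intCast]
      ring
    rw [this, hdiv]
    simp
  simp only [h3] at h2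
  have := hasSum_zero.unique h2
  rw [← Finset.mul_sum] at this
  simpa [boxVol_pos.ne'] using this.symm

/-- The Laplacian acts on all components by the same scalar -|k|². Thus Δu is again divergence-free,
and the pressure disappears when the scheme is tested with it. -/
lemma sum_mul_fc_vlap {u : Field} (hu : ∀ j, IsH2 (u j)) (hd : DivFree u) (k : Freq) :
    ∑ i, (k i : ℂ) * fc (vlap u i) k = 0 := by
  have := sum_mul_fc_of_divFree (fun j => (hu j).memH1.memL2) hd k
  have e : ∑ i, (k i : ℂ) * fc (vlap u i) k
      = -(∑ i, (k i : ℝ) ^ 2 : ℝ) * ∑ i, (k i : ℂ) * fc (u i) k := by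
    rw [Finset.mul_sum]
    refine Finset.sum_congr rfl fun i _ => ?_
    rw [vlap, fc_lap (hu i)]
    ring
  rw [e, this, mul_zero]

/-! ### The `H⁻¹` norm -/

/-- Normalize v by |∇v|; if |∇v| = 0, then |v| = 0 by the Poincaré inequality. -/
lemma l2Inner_le_hm1Norm {c₀ : ℝ}
    (hP : ∀ u : Field, (∀ j, IsH1 (u j)) → MeanZero u → l2Sq u ≤ c₀ * gradSq u)
    {f v : Field} (hf : ∀ j, IsL2 (f j)) (hv : ∀ j, IsH1 (v j)) (hm : MeanZero v) :
    l2Inner f v ≤ hm1Norm f * Real.sqrt (gradSq v) := by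
  -- The real `sSup` of an unbounded set is 0 by convention, so boundedness has to be checked before
  -- the supremum is an upper bound.
  have hbdd : BddAbove {r : ℝ | ∃ v : Field, (∀ j, IsH1 (v j)) ∧ MeanZero v ∧ gradSq v ≤ 1 ∧
      r = l2Inner f v} := by
    refine ⟨Real.sqrt (l2Sq f) * Real.sqrt |c₀|, ?_⟩
    rintro r ⟨w, hw, hwm, hw1, rfl⟩
    refine (le_abs_self _).trans ((abs_l2Inner_le hf fun j => (hw j).memL2).trans ?_)
    refine mul_le_mul_of_nonneg_left (Real.sqrt_le_sqrt ?_) (Real.sqrt_nonneg _)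
    calc l2Sq w ≤ c₀ * gradSq w := hP w hw hwm
      _ ≤ |c₀| * 1 := mul_le_mul (le_abs_self _) hw1 (gradSq_nonneg w) (abs_nonneg _)
      _ = |c₀| := mul_one _
  rcases (gradSq_nonneg v).eq_or_lt with h0 | hpos
  · have h1 := hP v hv hm
    rw [← h0, mul_zero] at h1
    have h2 := sq_l2Inner_le hf fun j => (hv j).memL2
    rw [le_antisymm h1 (l2Sq_nonneg v), mul_zero] at h2
    rw [← h0, Real.sqrt_zero, mul_zero]
    exact (pow_eq_zero_iff two_ne_zero).1 (le_antisymm h2 (sq_nonneg _)) |>.le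
  · have hs : 0 < Real.sqrt (gradSq v) := Real.sqrt_pos.2 hpos
    have hmem : l2Inner f (fun j x => (Real.sqrt (gradSq v))⁻¹ * v j x) ≤ hm1Norm f := by
      refine le_csSup hbdd ⟨_, fun j => (hv j).const_mul _, fun j => ?_, ?_, rfl⟩
      · rw [integral_const_mul, hm j, mul_zero]
      · rw [gradSq_const_mul hv, inv_pow, Real.sq_sqrt hpos.le, inv_mul_cancel₀ hpos.ne']
    have e : l2Inner f (fun j x => (Real.sqrt (gradSq v))⁻¹ * v j x)
        = (Real.sqrt (gradSq v))⁻¹ * l2Inner f v := by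
      rw [l2Inner, l2Inner, ← integral_const_mul]
      congr 1; ext x
      rw [Finset.mul_sum]
      exact Finset.sum_congr rfl fun j _ => by ring
    rw [e, inv_mul_le_iff₀ hs] at hmem
    linarith

lemma hm1Norm_le {c₀ : ℝ}
    (hP : ∀ u : Field, (∀ j, IsH1 (u j)) → MeanZero u → l2Sq u ≤ c₀ * gradSq u)
    (hc₀ : 0 ≤ c₀) {f : Field} (hf : ∀ j, IsL2 (f j)) :
    hm1Norm f ≤ Real.sqrt c₀ * l2Norm f := by
  refine Real.sSup_le ?_ (mul_nonneg (Real.sqrt_nonneg _) (Real.sqrt_nonneg _))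
  rintro r ⟨w, hw, hwm, hw1, rfl⟩
  refine (le_abs_self _).trans ((abs_l2Inner_le hf fun j => (hw j).memL2).trans ?_)
  rw [mul_comm, l2Norm]
  refine mul_le_mul_of_nonneg_right (Real.sqrt_le_sqrt ?_) (Real.sqrt_nonneg _)
  have := hP w hw hwm
  nlinarith

/-! ### Vanishing of the trilinear form -/

lemma tendsto_integral_mul {ι : Type*} {l : Filter ι} {a b : ι → E3 → ℝ} {a₀ b₀ : E3 → ℝ}
    (ha : ∀ s, IsL2 (a s)) (hb : ∀ s, IsL2 (b s)) (ha₀ : IsL2 a₀) (hb₀ : IsL2 b₀)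
    (hta : Tendsto (fun s => ∫ x in Omega, (a₀ x - a s x) ^ 2) l (𝓝 0))
    (htb : Tendsto (fun s => ∫ x in Omega, (b₀ x - b s x) ^ 2) l (𝓝 0)) :
    Tendsto (fun s => ∫ x in Omega, a s x * b s x) l (𝓝 (∫ x in Omega, a₀ x * b₀ x)) := by
  have conv : ∀ {g h : ι → E3 → ℝ}, (∀ s, IsL2 (g s)) → (∀ s, IsL2 (h s)) →
      Tendsto (fun s => (∫ x in Omega, g s x ^ 2) * ∫ x in Omega, h s x ^ 2) l (𝓝 0) →
      Tendsto (fun s => ∫ x in Omega, g s x * h s x) l (𝓝 0) := by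
    intro g h hg hh ht
    have h1 : Tendsto (fun s => (∫ x in Omega, g s x * h s x) ^ 2) l (𝓝 0) :=
      squeeze_zero (fun s => sq_nonneg _) (fun s => sq_integral_mul_le (hg s) (hh s)) ht
    rw [tendsto_zero_iff_abs_tendsto_zero]
    have h2 := (Real.continuous_sqrt.tendsto 0).comp h1
    simpa [Function.comp_def, Real.sqrt_sq_eq_abs] using h2
  have t1 := conv (fun s => ha₀.sub (ha s)) (fun s => hb₀.sub (hb s)) (by simpa using hta.mul htb)
  have t2 := conv (fun s => ha₀.sub (ha s)) (fun _ => hb₀) (by simpa using hta.mul_const _)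
  have t3 := conv (fun _ => ha₀) (fun s => hb₀.sub (hb s)) (by simpa using htb.const_mul _)
  -- This is ab = (a₀-a)(b₀-b) - (a₀-a)b₀ - a₀(b₀-b) + a₀b₀.
  have t4 := ((t1.sub t2).sub t3).add_const (∫ x in Omega, a₀ x * b₀ x)
  simp only [sub_zero, zero_add] at t4
  refine t4.congr fun s => ?_
  have i1 := (ha₀.sub (ha s)).integrable_mul (hb₀.sub (hb s))
  have i2 := (ha₀.sub (ha s)).integrable_mul hb₀
  have i3 := ha₀.integrable_mul (hb₀.sub (hb s))
  have i12 : Integrable (fun x => (a₀ x - a s x) * (b₀ x - b s x) - (a₀ x - a s x) * b₀ x)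
    (volume.restrict Omega) := i1.sub i2
  have i123 : Integrable (fun x => (a₀ x - a s x) * (b₀ x - b s x) - (a₀ x - a s x) * b₀ x
    - a₀ x * (b₀ x - b s x)) (volume.restrict Omega) := i12.sub i3
  rw [← integral_sub i1 i2, ← integral_sub i12 i3, ← integral_add i123 (ha₀.integrable_mul hb₀)]
  congr 1; ext x
  ring

lemma IsL2.bdd_mul {g a : E3 → ℝ} (ha : IsL2 a) (hg : IsL2 g) {A : ℝ}
    (hA : ∀ᵐ x ∂(volume.restrict Omega), |g x| ≤ A) : IsL2 (fun x => g x * a x) := by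
  refine MemLp.of_le_mul (c := A) ha (hg.1.mul ha.1) ?_
  filter_upwards [hA] with x hx
  rw [norm_mul]
  exact mul_le_mul_of_nonneg_right hx (norm_nonneg _)

lemma isL2_advect {u v : Field} (hu : ∀ j, IsL2 (u j)) (hv : ∀ j, IsH1 (v j)) {A : ℝ}
    (hA : ∀ j, ∀ᵐ x ∂(volume.restrict Omega), |u j x| ≤ A) (j : Fin 3) : IsL2 (advect u v j) :=
  IsL2.sum Finset.univ fun i => ((hv j).isL2_wd i).bdd_mul (hu i) (hA i)

/-- Formally the integrand is ½ u·∇|u|², and u is orthogonal to gradients. The square |u|² is not an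
admissible test function, so it is replaced by the sum of the squared truncations, while the
advecting factor u is kept. Boundedness of u keeps the products in L² and allows the passage to the
limit. -/
lemma l2Inner_advect_self {u : Field} (hu : ∀ j, IsH1 (u j)) (hd : DivFree u) {A : ℝ}
    (hA : ∀ j, ∀ᵐ x ∂(volume.restrict Omega), |u j x| ≤ A) : l2Inner (advect u u) u = 0 := by
  have hL : ∀ j, IsL2 (u j) := fun j => (hu j).memL2
  have hlim : ∀ i j, Tendsto
      (fun s : Finset Freq => ∫ x in Omega, (u i x * trunc s (u j) x) * trunc s (wd i (u j)) x)
      atTop (𝓝 (∫ x in Omega, (u i x * u j x) * wd i (u j) x)) := by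
    intro i j
    refine tendsto_integral_mul (fun s => (isL2_trunc s _).bdd_mul (hL i) (hA i))
      (fun s => isL2_trunc s _) ((hL j).bdd_mul (hL i) (hA i)) ((hu j).isL2_wd i) ?_
      (tendsto_integral_sub_trunc_sq ((hu j).isL2_wd i))
    have hz : Tendsto (fun s : Finset Freq => A ^ 2 * ∫ x in Omega, (u j x - trunc s (u j) x) ^ 2)
        atTop (𝓝 0) := by simpa using (tendsto_integral_sub_trunc_sq (hL j)).const_mul (A ^ 2)
    refine squeeze_zero (fun s => integral_nonneg fun x => sq_nonneg _) (fun s => ?_) hz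
    rw [← integral_const_mul]
    refine integral_mono_ae (((hL j).bdd_mul (hL i) (hA i)).sub
      ((isL2_trunc s _).bdd_mul (hL i) (hA i))).integrable_sq
      (((hL j).sub (isL2_trunc s _)).integrable_sq.const_mul _) ?_
    filter_upwards [hA i] with x hx
    have : u i x ^ 2 ≤ A ^ 2 := sq_le_sq' (neg_le_of_abs_le hx) (le_of_abs_le hx)
    have h2 : (u i x * u j x - u i x * trunc s (u j) x) ^ 2
        = u i x ^ 2 * (u j x - trunc s (u j) x) ^ 2 := by ring
    rw [h2]
    exact mul_le_mul_of_nonneg_right this (sq_nonneg _)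
  have hsum := tendsto_finsetSum (Finset.univ : Finset (Fin 3)) fun i _ =>
    tendsto_finsetSum (Finset.univ : Finset (Fin 3)) fun j _ => hlim i j
  have hzero : ∀ s : Finset Freq, ∑ i, ∑ j,
      ∫ x in Omega, (u i x * trunc s (u j) x) * trunc s (wd i (u j)) x = 0 := by
    intro s
    have ht : IsTest (fun x => ∑ j, trunc s (u j) x ^ 2) :=
      IsTest.sum fun j _ => (isTest_trunc s (u j)).pow 2
    have h0 := hd _ ht
    have hpd : ∀ i x, pd i (fun x => ∑ j, trunc s (u j) x ^ 2) x
        = 2 * ∑ j, trunc s (u j) x * trunc s (wd i (u j)) x := by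
      intro i x
      have hdiff : ∀ j, DifferentiableAt ℝ (trunc s (u j)) x := fun j =>
        ((isTest_trunc s (u j)).smooth.differentiable (by simp)).differentiableAt
      rw [pd, fderiv_fun_sum fun j _ => (hdiff j).fun_pow 2, sum_apply, Finset.mul_sum]
      refine Finset.sum_congr rfl fun j _ => ?_
      rw [fderiv_fun_pow _ (hdiff j), ← pd_trunc s (hu j), pd]
      simp
      ring
    simp only [hpd] at h0
    have hI : ∀ i j, Integrable (fun x => (u i x * trunc s (u j) x) * trunc s (wd i (u j)) x)
        (volume.restrict Omega) := fun i j =>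
      ((isL2_trunc s _).bdd_mul (hL i) (hA i)).integrable_mul (isL2_trunc s _)
    have e : ∑ i, ∑ j, ∫ x in Omega, (u i x * trunc s (u j) x) * trunc s (wd i (u j)) x
        = ∫ x in Omega, ∑ i, ∑ j, (u i x * trunc s (u j) x) * trunc s (wd i (u j)) x := by
      rw [integral_finsetSum _ fun i _ => integrable_finsetSum _ fun j _ => hI i j]
      refine Finset.sum_congr rfl fun i _ => ?_
      rw [integral_finsetSum _ fun j _ => hI i j]
    rw [e]
    have e2 : ∫ x in Omega, ∑ i, u i x * (2 * ∑ j, trunc s (u j) x * trunc s (wd i (u j)) x)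
        = 2 * ∫ x in Omega, ∑ i, ∑ j, (u i x * trunc s (u j) x) * trunc s (wd i (u j)) x := by
      rw [← integral_const_mul]
      congr 1; ext x
      simp only [Finset.mul_sum]
      refine Finset.sum_congr rfl fun i _ => Finset.sum_congr rfl fun j _ => ?_
      ring
    rw [e2] at h0
    linarith
  simp only [hzero] at hsum
  have h1 := tendsto_nhds_unique hsum tendsto_const_nhds
  rw [l2Inner_eq_sum (isL2_advect hL hu hA) hL]
  rw [Finset.sum_comm] at h1
  rw [← h1]
  refine Finset.sum_congr rfl fun j _ => ?_
  rw [← integral_finsetSum _ fun i _ =>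
    ((hL j).bdd_mul (hL i) (hA i)).integrable_mul ((hu j).isL2_wd i)]
  congr 1; ext x
  rw [advect, Finset.sum_mul]
  exact Finset.sum_congr rfl fun i _ => by ring

/-! ### Lattice sums -/

/-- The cube of wave vectors with components of modulus at most `N`. -/
def cube (N : ℕ) : Finset Freq := Finset.Icc (fun _ => -(N : ℤ)) (fun _ => (N : ℤ))

/-- The sup norm of a wave vector. -/
def supNorm (k : Freq) : ℕ := Finset.univ.sup fun i => (k i).natAbs

/-- The squared Euclidean norm of a wave vector. -/
def freqSq (k : Freq) : ℝ := ∑ i, (k i : ℝ) ^ 2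

lemma mem_cube {k : Freq} {N : ℕ} : k ∈ cube N ↔ supNorm k ≤ N := by
  rw [cube, Finset.mem_Icc, supNorm, Finset.sup_le_iff, Pi.le_def, Pi.le_def, ← forall_and]
  simp only [Finset.mem_univ, forall_true_left]
  exact forall_congr' fun i => by omega

lemma cube_subset {M N : ℕ} (h : M ≤ N) : cube M ⊆ cube N := fun _ hk =>
  mem_cube.2 ((mem_cube.1 hk).trans h)

lemma card_cube (N : ℕ) : (cube N).card = (2 * N + 1) ^ 3 := by
  rw [cube, Pi.card_Icc]
  simp only [Int.card_Icc, Finset.prod_const, Finset.card_univ, Fintype.card_fin]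
  congr 1
  omega

lemma supNorm_eq_zero {k : Freq} : supNorm k = 0 ↔ k = 0 := by
  rw [supNorm, ← Nat.le_zero, Finset.sup_le_iff]
  simp [funext_iff]

lemma supNorm_sq_le (k : Freq) : (supNorm k : ℝ) ^ 2 ≤ freqSq k := by
  obtain ⟨i, -, hi⟩ := Finset.exists_mem_eq_sup (Finset.univ : Finset (Fin 3))
    Finset.univ_nonempty fun i => (k i).natAbs
  have h : (supNorm k : ℝ) ^ 2 = (k i : ℝ) ^ 2 := by
    rw [supNorm, hi, Nat.cast_natAbs]
    push_cast
    rw [sq_abs]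
  rw [h]
  exact Finset.single_le_sum (f := fun i => (k i : ℝ) ^ 2) (fun j _ => sq_nonneg _)
    (Finset.mem_univ i)

lemma one_le_freqSq {k : Freq} (hk : k ≠ 0) : 1 ≤ freqSq k := by
  have h : 1 ≤ supNorm k := Nat.one_le_iff_ne_zero.2 (supNorm_eq_zero.not.2 hk)
  have h' : (1 : ℝ) ≤ supNorm k := by exact_mod_cast h
  nlinarith [supNorm_sq_le k]

lemma freqSq_nonneg (k : Freq) : 0 ≤ freqSq k := Finset.sum_nonneg fun _ _ => sq_nonneg _

/-- The shell where the sup norm equals N+1 has (2N+3)³ - (2N+1)³ points. Such exact counts are the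
reason for using the sup norm. -/
lemma sum_cube_succ_sdiff (N : ℕ) (f : ℕ → ℝ) :
    ∑ k ∈ cube (N + 1) \ cube N, f (supNorm k) = (24 * N ^ 2 + 48 * N + 26) * f (N + 1) := by
  have h : ∀ k ∈ cube (N + 1) \ cube N, f (supNorm k) = f (N + 1) := by
    intro k hk
    rw [Finset.mem_sdiff, mem_cube, mem_cube] at hk
    congr 1
    omega
  rw [Finset.sum_congr rfl h, Finset.sum_const, nsmul_eq_mul,
    Finset.cast_card_sdiff (cube_subset N.le_succ), card_cube, card_cube]
  push_cast
  ring

lemma sum_cube_inv_sq_le (N : ℕ) : ∑ k ∈ cube N, ((supNorm k : ℝ)⁻¹) ^ 2 ≤ 26 * N := by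
  induction N with
  | zero =>
    have : cube 0 = {0} := by
      ext k; rw [mem_cube, Nat.le_zero, supNorm_eq_zero, Finset.mem_singleton]
    -- The zero frequency contributes nothing, because 0⁻¹ = 0.
    rw [this, Finset.sum_singleton, supNorm_eq_zero.2 rfl]
    simp
  | succ N ih =>
    rw [← Finset.sum_sdiff (cube_subset N.le_succ),
      sum_cube_succ_sdiff N fun m => ((m : ℝ)⁻¹) ^ 2]
    have h : (24 * (N : ℝ) ^ 2 + 48 * N + 26) * (((N + 1 : ℕ) : ℝ)⁻¹) ^ 2 ≤ 26 := by
      rw [inv_pow, ← div_eq_mul_inv, div_le_iff₀ (by positivity)]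
      push_cast
      nlinarith [sq_nonneg (N : ℝ)]
    push_cast at h ⊢
    linarith

/-- The shell at N+1 contributes at most 26/(N+1)² ≤ 26 (1/N - 1/(N+1)), and these differences
telescope. -/
lemma sum_cube_sdiff_inv_pow_four_le {R N : ℕ} (hR : 1 ≤ R) (hN : R ≤ N) :
    ∑ k ∈ cube N \ cube R, (((supNorm k : ℝ) ^ 2)⁻¹) ^ 2 ≤ 26 * ((R : ℝ)⁻¹ - (N : ℝ)⁻¹) := by
  induction N, hN using Nat.le_induction with
  | base => simp
  | succ N hN ih =>
    have hN0 : (0 : ℝ) < N := by exact_mod_cast hR.trans hN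
    have hsplit : cube (N + 1) \ cube R = (cube (N + 1) \ cube N) ∪ (cube N \ cube R) := by
      ext k
      simp only [Finset.mem_union, Finset.mem_sdiff, mem_cube]
      omega
    have hdisj : Disjoint (cube (N + 1) \ cube N) (cube N \ cube R) := by
      rw [Finset.disjoint_left]
      intro k
      simp only [Finset.mem_sdiff, mem_cube]
      omega
    rw [hsplit, Finset.sum_union hdisj, sum_cube_succ_sdiff N fun m => (((m : ℝ) ^ 2)⁻¹) ^ 2]
    have h : (24 * (N : ℝ) ^ 2 + 48 * N + 26) * ((((N + 1 : ℕ) : ℝ) ^ 2)⁻¹) ^ 2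
        ≤ 26 * ((N : ℝ)⁻¹ - ((N + 1 : ℕ) : ℝ)⁻¹) := by
      push_cast
      have e : 26 * ((N : ℝ)⁻¹ - ((N : ℝ) + 1)⁻¹) = 26 / (N * (N + 1)) := by
        field_simp; ring
      rw [e, inv_pow, ← div_eq_mul_inv, div_le_div_iff₀ (by positivity) (by positivity)]
      have h1 : 24 * (N : ℝ) ^ 2 + 48 * N + 26 ≤ 26 * (N + 1) ^ 2 := by nlinarith [sq_nonneg (N : ℝ)]
      have h2 : (N : ℝ) * (N + 1) ≤ (N + 1) ^ 2 := by nlinarith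
      calc _ ≤ 26 * ((N : ℝ) + 1) ^ 2 * (N + 1) ^ 2 := by gcongr
        _ = _ := by ring
    linarith

/-! ### Gradient norms in Fourier variables -/

/-- `∫ |∇g|²` for a scalar function. -/
def dirichlet (g : E3 → ℝ) : ℝ := ∑ i, ∫ x in Omega, wd i g x ^ 2

lemma dirichlet_nonneg (g : E3 → ℝ) : 0 ≤ dirichlet g :=
  Finset.sum_nonneg fun _ _ => integral_nonneg fun _ => sq_nonneg _

lemma gradSq_eq_sum_dirichlet {u : Field} (hu : ∀ j, IsH1 (u j)) :
    gradSq u = ∑ j, dirichlet (u j) := by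
  rw [gradSq_eq_gradInner, gradInner_eq_sum hu hu, Finset.sum_comm]
  simp only [dirichlet, sq]

lemma l2Sq_eq_sum {u : Field} (hu : ∀ j, IsL2 (u j)) :
    l2Sq u = ∑ j, ∫ x in Omega, u j x ^ 2 :=
  integral_finsetSum _ fun j _ => (hu j).integrable_sq

lemma dirichlet_le_gradSq {u : Field} (hu : ∀ j, IsH1 (u j)) (j : Fin 3) :
    dirichlet (u j) ≤ gradSq u := by
  rw [gradSq_eq_sum_dirichlet hu]
  exact Finset.single_le_sum (f := fun j => dirichlet (u j)) (fun j _ => dirichlet_nonneg _)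
    (Finset.mem_univ j)

lemma integral_sq_le_l2Sq {u : Field} (hu : ∀ j, IsL2 (u j)) (j : Fin 3) :
    ∫ x in Omega, u j x ^ 2 ≤ l2Sq u := by
  rw [l2Sq_eq_sum hu]
  exact Finset.single_le_sum (f := fun j => ∫ x in Omega, u j x ^ 2)
    (fun j _ => integral_nonneg fun _ => sq_nonneg _) (Finset.mem_univ j)

lemma hasSum_dirichlet {g : E3 → ℝ} (hg : IsH1 g) :
    HasSum (fun k => freqSq k * ‖fc g k‖ ^ 2) (boxVol⁻¹ * dirichlet g) := by
  have := hasSum_sum (s := Finset.univ) fun i (_ : i ∈ Finset.univ) => hasSum_fc_sq (hg.isL2_wd i)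
  rw [dirichlet, Finset.mul_sum]
  refine this.congr_fun fun k => ?_
  rw [freqSq, Finset.sum_mul]
  refine Finset.sum_congr rfl fun i _ => ?_
  rw [fc_wd hg, norm_mul, norm_mul, Complex.norm_I, one_mul, mul_pow, Complex.norm_intCast, sq_abs]

lemma hasSum_lap_sq {g : E3 → ℝ} (hg : IsH2 g) :
    HasSum (fun k => freqSq k ^ 2 * ‖fc g k‖ ^ 2) (boxVol⁻¹ * ∫ x in Omega, lap g x ^ 2) := by
  refine (hasSum_fc_sq (isL2_lap hg)).congr_fun fun k => ?_
  rw [fc_lap hg, norm_mul, mul_pow, norm_neg, Complex.norm_real, Real.norm_eq_abs, sq_abs]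
  rfl

/-- The Poincaré inequality for scalar functions. -/
lemma integral_sq_le_dirichlet {g : E3 → ℝ} (hg : IsH1 g) (h0 : fc g 0 = 0) :
    ∫ x in Omega, g x ^ 2 ≤ dirichlet g := by
  refine le_of_mul_le_mul_left ?_ (inv_pos.2 boxVol_pos)
  refine hasSum_le (fun k => ?_) (hasSum_fc_sq hg.memL2) (hasSum_dirichlet hg)
  rcases eq_or_ne k 0 with rfl | hk
  · simp [h0]
  · exact le_mul_of_one_le_left (sq_nonneg _) (one_le_freqSq hk)

lemma dirichlet_le_integral_lap_sq {g : E3 → ℝ} (hg : IsH2 g) :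
    dirichlet g ≤ ∫ x in Omega, lap g x ^ 2 := by
  refine le_of_mul_le_mul_left ?_ (inv_pos.2 boxVol_pos)
  refine hasSum_le (fun k => ?_) (hasSum_dirichlet hg.memH1) (hasSum_lap_sq hg)
  rcases eq_or_ne k 0 with rfl | hk
  · simp [freqSq]
  · refine mul_le_mul_of_nonneg_right ?_ (sq_nonneg _)
    nlinarith [one_le_freqSq hk]

lemma l2Sq_le_gradSq {u : Field} (hu : ∀ j, IsH1 (u j)) (hm : MeanZero u) :
    l2Sq u ≤ gradSq u := by
  rw [l2Sq_eq_sum fun j => (hu j).memL2, gradSq_eq_sum_dirichlet hu]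
  exact Finset.sum_le_sum fun j _ => integral_sq_le_dirichlet (hu j)
    (fc_zero_of_integral_eq_zero (hu j).memL2 (hm j))

lemma gradSq_le_l2Sq_vlap {u : Field} (hu : ∀ j, IsH2 (u j)) :
    gradSq u ≤ l2Sq (vlap u) := by
  rw [l2Sq_eq_sum (u := vlap u) fun j => isL2_lap (hu j),
    gradSq_eq_sum_dirichlet fun j => (hu j).memH1]
  exact Finset.sum_le_sum fun j _ => dirichlet_le_integral_lap_sq (hu j)

/-! ### Agmon's inequality -/

/-- Low frequencies: Cauchy–Schwarz with the weight |k|, where the sum of |k|⁻² over the cube grows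
like R. -/
lemma sq_sum_cube_le {g : E3 → ℝ} (hg : IsH1 g) (h0 : fc g 0 = 0) (R : ℕ) :
    (∑ k ∈ cube R, ‖fc g k‖) ^ 2 ≤ 26 * R * (boxVol⁻¹ * dirichlet g) := by
  have e : ∑ k ∈ cube R, ‖fc g k‖
      = ∑ k ∈ cube R, (supNorm k : ℝ)⁻¹ * (supNorm k * ‖fc g k‖) := by
    refine Finset.sum_congr rfl fun k _ => ?_
    rcases eq_or_ne k 0 with rfl | hk
    · simp [h0]
    · have : (supNorm k : ℝ) ≠ 0 := by exact_mod_cast supNorm_eq_zero.not.2 hk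
      rw [inv_mul_cancel_left₀ this]
  rw [e]
  refine (Finset.sum_mul_sq_le_sq_mul_sq _ _ _).trans ?_
  refine mul_le_mul (sum_cube_inv_sq_le R) ?_ (Finset.sum_nonneg fun _ _ => sq_nonneg _)
    (by positivity)
  refine le_trans (Finset.sum_le_sum fun k _ => ?_)
    (sum_le_hasSum (cube R) (fun k _ => mul_nonneg (freqSq_nonneg k) (sq_nonneg _))
      (hasSum_dirichlet hg))
  rw [mul_pow]
  exact mul_le_mul_of_nonneg_right (supNorm_sq_le k) (sq_nonneg _)

/-- High frequencies: Cauchy–Schwarz with the weight |k|², where the tail of the sum of |k|⁻⁴ decays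
like 1/R. -/
lemma sq_sum_cube_sdiff_le {g : E3 → ℝ} (hg : IsH2 g) {R N : ℕ} (hR : 1 ≤ R) (hN : R ≤ N) :
    (∑ k ∈ cube N \ cube R, ‖fc g k‖) ^ 2
      ≤ 26 * (R : ℝ)⁻¹ * (boxVol⁻¹ * ∫ x in Omega, lap g x ^ 2) := by
  have e : ∑ k ∈ cube N \ cube R, ‖fc g k‖
      = ∑ k ∈ cube N \ cube R, ((supNorm k : ℝ) ^ 2)⁻¹ * (supNorm k ^ 2 * ‖fc g k‖) := by
    refine Finset.sum_congr rfl fun k hk => ?_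
    have h : (supNorm k : ℝ) ≠ 0 := by
      rw [Finset.mem_sdiff, mem_cube, mem_cube] at hk
      exact_mod_cast (by omega : supNorm k ≠ 0)
    rw [inv_mul_cancel_left₀ (pow_ne_zero 2 h)]
  rw [e]
  refine (Finset.sum_mul_sq_le_sq_mul_sq _ _ _).trans ?_
  refine mul_le_mul ((sum_cube_sdiff_inv_pow_four_le hR hN).trans ?_) ?_
    (Finset.sum_nonneg fun _ _ => sq_nonneg _) (by positivity)
  · have : (0 : ℝ) ≤ (N : ℝ)⁻¹ := by positivity
    linarith
  refine le_trans (Finset.sum_le_sum fun k _ => ?_)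
    (sum_le_hasSum (cube N \ cube R) (fun k _ => mul_nonneg (sq_nonneg (freqSq k)) (sq_nonneg _))
      (hasSum_lap_sq hg))
  rw [mul_pow]
  exact mul_le_mul_of_nonneg_right (pow_le_pow_left₀ (sq_nonneg _) (supNorm_sq_le k) 2)
    (sq_nonneg _)

lemma exists_subset_cube (s : Finset Freq) (R : ℕ) : ∃ N, R ≤ N ∧ s ⊆ cube N :=
  ⟨max R (s.sup supNorm), le_max_left _ _, fun _ hk =>
    mem_cube.2 ((Finset.le_sup hk).trans (le_max_right _ _))⟩

/-- **Agmon's inequality** on the box. -/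
lemma ae_abs_le_agmon {g : E3 → ℝ} (hg : IsH2 g) (h0 : fc g 0 = 0) :
    ∀ᵐ x ∂(volume.restrict Omega), |g x| ≤
      Real.sqrt (156 * boxVol⁻¹ * Real.sqrt (dirichlet g * ∫ x in Omega, lap g x ^ 2)) := by
  set W := dirichlet g with hW
  set Z := ∫ x in Omega, lap g x ^ 2 with hZ
  have hWZ : W ≤ Z := dirichlet_le_integral_lap_sq hg
  have hW0 : 0 ≤ W := dirichlet_nonneg g
  have hb := boxVol_pos
  refine ae_abs_le_of_sum_norm_fc_le hg.memH1.memL2 fun s => Real.le_sqrt_of_sq_le ?_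
  rcases hW0.eq_or_lt with hW1 | hW1
  · obtain ⟨N, -, hN⟩ := exists_subset_cube s 0
    have h1 := sq_sum_cube_le hg.memH1 h0 N
    rw [← hW, ← hW1, mul_zero, mul_zero] at h1
    refine le_trans ?_ (h1.trans (by positivity))
    exact pow_le_pow_left₀ (Finset.sum_nonneg fun _ _ => norm_nonneg _)
      (Finset.sum_le_sum_of_subset_of_nonneg hN fun _ _ _ => norm_nonneg _) 2
  set p := Real.sqrt W with hp
  set d := Real.sqrt Z with hd
  have hp0 : 0 < p := Real.sqrt_pos.2 hW1
  have hpd : p ≤ d := Real.sqrt_le_sqrt hWZ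
  have hpp : p ^ 2 = W := Real.sq_sqrt hW0
  have hdd : d ^ 2 = Z := Real.sq_sqrt (hW0.trans hWZ)
  have hd0 : 0 < d := hp0.trans_le hpd
  -- This cutoff balances R W against Z/R: both become comparable with √(WZ). The integers force d ≥
  -- p, so R ≥ 1 and rounding loses at most a factor 2.
  set R := ⌊d / p⌋₊ with hR
  have h1R : 1 ≤ R := (Nat.one_le_floor_iff _).2 ((one_le_div hp0).2 hpd)
  have hRle : (R : ℝ) ≤ d / p := Nat.floor_le (by positivity)
  have hRge : d / p ≤ 2 * R := by
    have h2 := Nat.lt_floor_add_one (d / p)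
    have h3 : (1 : ℝ) ≤ R := by exact_mod_cast h1R
    rw [← hR] at h2
    linarith
  have hR0 : (0 : ℝ) < R := by exact_mod_cast h1R
  obtain ⟨N, hRN, hN⟩ := exists_subset_cube s R
  have hsum : ∑ k ∈ s, ‖fc g k‖ ≤
      ∑ k ∈ cube N \ cube R, ‖fc g k‖ + ∑ k ∈ cube R, ‖fc g k‖ := by
    rw [Finset.sum_sdiff (cube_subset hRN)]
    exact Finset.sum_le_sum_of_subset_of_nonneg hN fun _ _ _ => norm_nonneg _
  have hlow := sq_sum_cube_le hg.memH1 h0 R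
  have hhigh := sq_sum_cube_sdiff_le hg h1R hRN
  rw [← hW] at hlow
  rw [← hZ] at hhigh
  have e : Real.sqrt (W * Z) = p * d := by rw [Real.sqrt_mul hW0]
  rw [e]
  have hl : (R : ℝ) * W ≤ p * d := by
    rw [le_div_iff₀ hp0] at hRle
    rw [← hpp]
    nlinarith
  have hh : (R : ℝ)⁻¹ * Z ≤ 2 * (p * d) := by
    rw [inv_mul_le_iff₀ hR0, ← hdd]
    rw [div_le_iff₀ hp0] at hRge
    nlinarith
  set a := ∑ k ∈ cube N \ cube R, ‖fc g k‖
  set b := ∑ k ∈ cube R, ‖fc g k‖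
  have hs0 : 0 ≤ ∑ k ∈ s, ‖fc g k‖ := Finset.sum_nonneg fun _ _ => norm_nonneg _
  calc (∑ k ∈ s, ‖fc g k‖) ^ 2 ≤ (a + b) ^ 2 := pow_le_pow_left₀ hs0 hsum 2
    _ ≤ 2 * (a ^ 2 + b ^ 2) := add_sq_le
    _ ≤ 2 * (26 * (R : ℝ)⁻¹ * (boxVol⁻¹ * Z) + 26 * R * (boxVol⁻¹ * W)) := by gcongr
    _ = 52 * boxVol⁻¹ * ((R : ℝ)⁻¹ * Z + R * W) := by ring
    _ ≤ 52 * boxVol⁻¹ * (2 * (p * d) + p * d) := by gcongr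
    _ = 156 * boxVol⁻¹ * (p * d) := by ring

/-! ### Bounds of the advection term for H² fields -/

lemma IsSolH2.fc_zero {u : Field} (hu : IsSolH2 u) (j : Fin 3) : fc (u j) 0 = 0 :=
  fc_zero_of_integral_eq_zero (hu.reg j).memH1.memL2 (hu.mean j)

lemma IsSolH2.ae_abs_le {u : Field} (hu : IsSolH2 u) (j : Fin 3) :
    ∀ᵐ x ∂(volume.restrict Omega), |u j x| ≤
      Real.sqrt (156 * boxVol⁻¹ * Real.sqrt (gradSq u * l2Sq (vlap u))) := by
  filter_upwards [ae_abs_le_agmon (hu.reg j) (hu.fc_zero j)] with x hx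
  refine hx.trans (Real.sqrt_le_sqrt (mul_le_mul_of_nonneg_left (Real.sqrt_le_sqrt ?_) ?_))
  · exact mul_le_mul (dirichlet_le_gradSq (fun j => (hu.reg j).memH1) j)
      (integral_sq_le_l2Sq (u := vlap u) (fun j => isL2_lap (hu.reg j)) j)
      (integral_nonneg fun _ => sq_nonneg _) (gradSq_nonneg u)
  · have := boxVol_pos
    positivity

lemma l2Sq_advect_le {u v : Field} (hu : ∀ j, IsL2 (u j)) (hv : ∀ j, IsH1 (v j)) {A : ℝ}
    (hA : ∀ j, ∀ᵐ x ∂(volume.restrict Omega), |u j x| ≤ A) :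
    l2Sq (advect u v) ≤ 3 * A ^ 2 * gradSq v := by
  rw [l2Sq, gradSq, ← integral_const_mul]
  refine integral_mono_ae (integrable_finsetSum _ fun j _ => (isL2_advect hu hv hA j).integrable_sq)
    ((integrable_finsetSum _ fun i _ => integrable_finsetSum _ fun j _ =>
      ((hv j).isL2_wd i).integrable_sq).const_mul _) ?_
  filter_upwards [ae_all_iff.2 hA] with x hx
  rw [Finset.sum_comm, Finset.mul_sum]
  refine Finset.sum_le_sum fun j _ => ?_
  rw [advect]
  refine (Finset.sum_mul_sq_le_sq_mul_sq _ _ _).trans ?_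
  refine mul_le_mul_of_nonneg_right ?_ (Finset.sum_nonneg fun _ _ => sq_nonneg _)
  calc ∑ i, u i x ^ 2 ≤ ∑ _i : Fin 3, A ^ 2 :=
        Finset.sum_le_sum fun i _ => sq_le_sq' (neg_le_of_abs_le (hx i)) (le_of_abs_le (hx i))
    _ = 3 * A ^ 2 := by simp

/-- The bound of `(u·∇u, Δu)`. -/
lemma abs_l2Inner_advect_vlap_le {u : Field} (hu : IsSolH2 u) {ν : ℝ} (hν : 0 < ν) :
    |l2Inner (advect u u) (vlap u)|
      ≤ (4 * (468 * boxVol⁻¹) ^ 2) / (2 * ν ^ 3) * gradSq u ^ 3 + ν / 2 * l2Sq (vlap u) := by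
  have hH1 : ∀ j, IsH1 (u j) := fun j => (hu.reg j).memH1
  have hL2 : ∀ j, IsL2 (u j) := fun j => (hH1 j).memL2
  have hb := boxVol_pos
  set G := gradSq u
  set D := l2Sq (vlap u)
  have hG : 0 ≤ G := gradSq_nonneg u
  have hD : 0 ≤ D := l2Sq_nonneg _
  have h1 := sq_l2Inner_le (isL2_advect hL2 hH1 hu.ae_abs_le)
    (v := vlap u) fun j => isL2_lap (hu.reg j)
  have h2 := l2Sq_advect_le hL2 hH1 hu.ae_abs_le
  rw [Real.sq_sqrt (by positivity)] at h2
  have h3 : l2Inner (advect u u) (vlap u) ^ 2 ≤ 468 * boxVol⁻¹ * Real.sqrt (G * D) * (G * D) := by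
    refine h1.trans ((mul_le_mul_of_nonneg_right h2 hD).trans (le_of_eq ?_))
    ring
  set y := l2Inner (advect u u) (vlap u)
  have h4 : y ^ 4 ≤ (468 * boxVol⁻¹) ^ 2 * (G * D) ^ 3 := by
    have h5 := pow_le_pow_left₀ (sq_nonneg y) h3 2
    have h6 := Real.sq_sqrt (mul_nonneg hG hD)
    calc y ^ 4 = (y ^ 2) ^ 2 := by ring
      _ ≤ _ := h5
      _ = (468 * boxVol⁻¹) ^ 2 * (Real.sqrt (G * D) ^ 2) * (G * D) ^ 2 := by ring
      _ = _ := by rw [h6]; ring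
  have hpos : 0 ≤ (4 * (468 * boxVol⁻¹) ^ 2) / (2 * ν ^ 3) * G ^ 3 := by positivity
  have hpos' : 0 ≤ ν / 2 * D := by positivity
  refine le_of_pow_le_pow_left₀ four_ne_zero (add_nonneg hpos hpos') ?_
  rw [show |y| ^ 4 = y ^ 4 from (even_two_mul 2).pow_abs y]
  refine h4.trans ?_
  -- Young's inequality with exponents 4 and 4/3, in the root-free form 4ab³ ≤ (a+b)⁴. The constant
  -- in a is the one for which 4ab³ is exactly the bound of y⁴; here 468 = 3 · 156 comes from
  -- Agmon's inequality.
  have h7 : (468 * boxVol⁻¹) ^ 2 * (G * D) ^ 3 = 4 *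
      ((4 * (468 * boxVol⁻¹) ^ 2) / (2 * ν ^ 3) * G ^ 3) * (ν / 2 * D) ^ 3 := by
    field_simp; ring
  rw [h7]
  set a := (4 * (468 * boxVol⁻¹) ^ 2) / (2 * ν ^ 3) * G ^ 3
  set b := ν / 2 * D
  have h8 : (a + b) ^ 4 = 4 * a * b ^ 3 + (a ^ 4 + 4 * a ^ 3 * b + 6 * a ^ 2 * b ^ 2 + b ^ 4) := by
    ring
  rw [h8]
  have : 0 ≤ a ^ 4 + 4 * a ^ 3 * b + 6 * a ^ 2 * b ^ 2 + b ^ 4 := by positivity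
  linarith

/-! ### The Sobolev inequality `‖g‖_{L⁶} ≤ C ‖∇g‖_{L²}` -/

/-- A distributional estimate from the splitting of `g` at the frequency `R`. -/
lemma mul_meas_le_abs_le {g : E3 → ℝ} (hg : IsH1 g) (h0 : fc g 0 = 0) {t : ℝ} (ht : 0 < t) {R : ℕ}
    (hR : 26 * R * (boxVol⁻¹ * dirichlet g) ≤ (t / 2) ^ 2) :
    ENNReal.ofReal ((t / 2) ^ 2) * (volume.restrict Omega) {x | t ≤ |g x|}
      ≤ ENNReal.ofReal boxVol * ∑' k, if k ∈ cube R then 0 else ENNReal.ofReal (‖fc g k‖ ^ 2) := by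
  -- The low part is at most t/2, so |g| ≥ t forces the high part to be at least t/2, and
  -- Chebyshev's inequality applies to it.
  have hlow : ∑ k ∈ cube R, ‖fc g k‖ ≤ t / 2 :=
    le_of_pow_le_pow_left₀ two_ne_zero (by positivity) ((sq_sum_cube_le hg h0 R).trans hR)
  have hsub : {x | t ≤ |g x|}
      ⊆ {x | ENNReal.ofReal ((t / 2) ^ 2) ≤ ENNReal.ofReal ((g x - trunc (cube R) g x) ^ 2)} := by
    intro x hx
    refine ENNReal.ofReal_le_ofReal ?_
    have h1 := (abs_trunc_le (cube R) g x).trans hlow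
    have h2 := abs_sub_abs_le_abs_sub (g x) (trunc (cube R) g x)
    have h3 : t ≤ |g x| := hx
    rw [sq_le_sq, abs_of_nonneg (by positivity)]
    linarith
  have hL := hg.memL2.sub (isL2_trunc (cube R) g)
  have hS : HasSum (fun k => if k ∈ cube R then 0 else ‖fc g k‖ ^ 2)
      (boxVol⁻¹ * (∫ x in Omega, g x ^ 2) - ∑ k ∈ cube R, ‖fc g k‖ ^ 2) := by
    have h1 : HasSum (fun k => if k ∈ cube R then ‖fc g k‖ ^ 2 else 0)
        (∑ k ∈ cube R, ‖fc g k‖ ^ 2) := by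
      have := hasSum_sum_of_ne_finset_zero (s := cube R) (L := .unconditional _)
        (f := fun k => if k ∈ cube R then ‖fc g k‖ ^ 2 else 0) fun k hk => if_neg hk
      rwa [Finset.sum_congr rfl fun k hk => if_pos hk] at this
    refine ((hasSum_fc_sq hg.memL2).sub h1).congr_fun fun k => ?_
    split_ifs <;> simp
  calc _ ≤ ENNReal.ofReal ((t / 2) ^ 2) * (volume.restrict Omega)
        {x | ENNReal.ofReal ((t / 2) ^ 2) ≤ ENNReal.ofReal ((g x - trunc (cube R) g x) ^ 2)} := by
        gcongr
    _ ≤ ∫⁻ x in Omega, ENNReal.ofReal ((g x - trunc (cube R) g x) ^ 2) :=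
        mul_meas_ge_le_lintegral₀ (hL.1.aemeasurable.pow_const 2).ennreal_ofReal _
    _ = ENNReal.ofReal (∫ x in Omega, (g x - trunc (cube R) g x) ^ 2) :=
        (ofReal_integral_eq_lintegral_ofReal hL.integrable_sq
          (Eventually.of_forall fun _ => sq_nonneg _)).symm
    _ ≤ ENNReal.ofReal (boxVol *
          (boxVol⁻¹ * (∫ x in Omega, g x ^ 2) - ∑ k ∈ cube R, ‖fc g k‖ ^ 2)) :=
        ENNReal.ofReal_le_ofReal (integral_sub_trunc_sq_le hg.memL2 _)
    _ = _ := by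
        rw [ENNReal.ofReal_mul boxVol_pos.le, ← hS.tsum_eq, ENNReal.ofReal_tsum_of_nonneg
          (fun k => by split_ifs <;> positivity) hS.summable]
        congr 2; ext k
        split_ifs <;> simp

lemma one_le_boxVol : 1 ≤ boxVol :=
  one_le_pow₀ (by linarith [Real.pi_gt_three])

/-- **Sobolev's inequality** on the box, by the method of Chemin and Xu. -/
lemma lintegral_pow_six_le {g : E3 → ℝ} (hg : IsH1 g) (h0 : fc g 0 = 0) :
    ∫⁻ x in Omega, ENNReal.ofReal (|g x| ^ (6 : ℝ))
      ≤ ENNReal.ofReal ((24 * 104 ^ 2 * dirichlet g) ^ 3) := by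
  set W := boxVol⁻¹ * dirichlet g with hW
  have hb := boxVol_pos
  have hW0 : 0 ≤ W := mul_nonneg (inv_nonneg.2 hb.le) (dirichlet_nonneg g)
  rcases hW0.eq_or_lt with hz | hpos
  · have hfc : ∀ k, fc g k = fc (fun x => g x - g x) k := by
      intro k
      rw [fc_sub hg.memL2 hg.memL2, sub_self]
      rcases eq_or_ne k 0 with rfl | hk
      · exact h0
      · have h1 := le_hasSum (hasSum_dirichlet hg) k
          fun j _ => mul_nonneg (freqSq_nonneg j) (sq_nonneg _)
        rw [← hW, ← hz] at h1
        have h2 := one_le_freqSq hk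
        have h3 : ‖fc g k‖ ^ 2 ≤ 0 := by nlinarith [sq_nonneg ‖fc g k‖]
        simpa using (pow_eq_zero_iff two_ne_zero).1 (le_antisymm h3 (sq_nonneg _))
    have hae := ae_eq_of_fc_eq hg.memL2 (hg.memL2.sub hg.memL2) hfc
    rw [lintegral_congr_ae (g := fun _ => 0)]
    · simp
    · filter_upwards [hae] with x hx
      rw [sub_self] at hx
      simp [hx]
  rw [lintegral_rpow_eq_lintegral_meas_le_mul (volume.restrict Omega)
    (Eventually.of_forall fun x => abs_nonneg (g x)) hg.memL2.1.aemeasurable.abs (by norm_num)]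
  -- The cutoff depends on the level t in the layer-cake formula. A frequency k lies above the
  -- cutoff exactly when t < T k, so after exchanging sum and integral k contributes at most T k⁴
  -- |ĝ(k)|², which is proportional to |k|²|ĝ(k)|².
  set T : Freq → ℝ := fun k => Real.sqrt (104 * W * supNorm k) with hT
  set c : Freq → ℝ≥0∞ := fun k => ENNReal.ofReal (4 * boxVol * T k ^ 3 * ‖fc g k‖ ^ 2) with hc
  have hpt : ∀ t ∈ Set.Ioi (0 : ℝ),
      (volume.restrict Omega) {x | t ≤ |g x|} * ENNReal.ofReal (t ^ ((6 : ℝ) - 1))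
        ≤ ∑' k, (Set.Iio (T k)).indicator (fun _ => c k) t := by
    intro t ht
    have ht0 : (0 : ℝ) < t := ht
    -- The largest cutoff with 26 R W ≤ (t/2)², whence 104 = 4 · 26.
    set R := ⌊t ^ 2 / (104 * W)⌋₊ with hR
    have hRle : (R : ℝ) ≤ t ^ 2 / (104 * W) := Nat.floor_le (by positivity)
    rw [le_div_iff₀ (by positivity)] at hRle
    have h1 := mul_meas_le_abs_le hg h0 ht0 (R := R) (by rw [← hW]; nlinarith)
    have e : ENNReal.ofReal (t ^ ((6 : ℝ) - 1))
        = ENNReal.ofReal (4 * t ^ 3) * ENNReal.ofReal ((t / 2) ^ 2) := by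
      rw [← ENNReal.ofReal_mul (by positivity)]
      congr 1
      rw [show (6 : ℝ) - 1 = ((5 : ℕ) : ℝ) by norm_num, Real.rpow_natCast]
      ring
    rw [e, mul_comm, mul_assoc]
    refine (mul_le_mul_right h1 _).trans ?_
    rw [← mul_assoc, ← ENNReal.ofReal_mul (by positivity), ← ENNReal.tsum_mul_left]
    refine ENNReal.tsum_le_tsum fun k => ?_
    by_cases hk : k ∈ cube R
    · simp [hk]
    · have hlt : t < T k := by
        rw [mem_cube, not_le, hR, Nat.floor_lt (by positivity), div_lt_iff₀ (by positivity)] at hk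
        exact Real.lt_sqrt_of_sq_lt (by linarith)
      rw [if_neg hk, Set.indicator_of_mem (Set.mem_Iio.2 hlt), hc,
        ← ENNReal.ofReal_mul (by positivity)]
      refine ENNReal.ofReal_le_ofReal (mul_le_mul_of_nonneg_right ?_ (sq_nonneg _))
      have : t ^ 3 ≤ T k ^ 3 := pow_le_pow_left₀ ht0.le hlt.le 3
      nlinarith
  have hint : ∫⁻ t in Set.Ioi (0 : ℝ),
      (volume.restrict Omega) {x | t ≤ |g x|} * ENNReal.ofReal (t ^ ((6 : ℝ) - 1))
        ≤ ENNReal.ofReal (4 * boxVol * (104 * W) ^ 2 * W) := by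
    calc _ ≤ ∫⁻ t in Set.Ioi (0 : ℝ), ∑' k, (Set.Iio (T k)).indicator (fun _ => c k) t :=
          setLIntegral_mono' measurableSet_Ioi hpt
      _ = ∑' k, ∫⁻ t in Set.Ioi (0 : ℝ), (Set.Iio (T k)).indicator (fun _ => c k) t :=
          lintegral_tsum fun k => (measurable_const.indicator measurableSet_Iio).aemeasurable
      _ = ∑' k, ENNReal.ofReal (4 * boxVol * (104 * W) ^ 2 * (supNorm k ^ 2 * ‖fc g k‖ ^ 2)) := by
          refine tsum_congr fun k => ?_
          have hT0 : 0 ≤ T k := Real.sqrt_nonneg _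
          rw [lintegral_indicator measurableSet_Iio, setLIntegral_const,
            Measure.restrict_apply measurableSet_Iio, Set.inter_comm, Set.Ioi_inter_Iio,
            Real.volume_Ioo, hc, ← ENNReal.ofReal_mul (by positivity)]
          congr 1
          have : T k ^ 4 = (104 * W * supNorm k) ^ 2 := by
            rw [show T k ^ 4 = (T k ^ 2) ^ 2 by ring, hT, Real.sq_sqrt (by positivity)]
          linear_combination (4 * boxVol * ‖fc g k‖ ^ 2) * this
      _ ≤ ∑' k, ENNReal.ofReal (4 * boxVol * (104 * W) ^ 2 * (freqSq k * ‖fc g k‖ ^ 2)) := by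
          refine ENNReal.tsum_le_tsum fun k => ENNReal.ofReal_le_ofReal ?_
          gcongr
          exact supNorm_sq_le k
      _ = _ := by
          have hs := (hasSum_dirichlet hg).mul_left (4 * boxVol * (104 * W) ^ 2)
          rw [← ENNReal.ofReal_tsum_of_nonneg (fun k => mul_nonneg (by positivity)
            (mul_nonneg (freqSq_nonneg k) (sq_nonneg _))) hs.summable, hs.tsum_eq]
  refine (mul_le_mul_right hint _).trans ?_
  rw [← ENNReal.ofReal_mul (by norm_num)]
  refine ENNReal.ofReal_le_ofReal ?_
  have hd := dirichlet_nonneg g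
  have hWd : W ≤ dirichlet g := by
    rw [hW, inv_mul_le_iff₀ hb]
    exact le_mul_of_one_le_left hd one_le_boxVol
  have e : boxVol * W = dirichlet g := by rw [hW, mul_inv_cancel_left₀ hb.ne']
  calc 6 * (4 * boxVol * (104 * W) ^ 2 * W) = 24 * 104 ^ 2 * W ^ 2 * (boxVol * W) := by ring
    _ ≤ 24 * 104 ^ 2 * dirichlet g ^ 2 * dirichlet g := by rw [e]; gcongr
    _ ≤ (24 * 104 ^ 2 * dirichlet g) ^ 3 := by
        have : 0 ≤ dirichlet g ^ 3 := by positivity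
        nlinarith

/-- Hölder's inequality with exponents `3`, `2`, `6`, with interpolation of `L³` between `L²` and
`L⁶`. -/
lemma lintegral_mul_mul_pow_four_le {α : Type*} [MeasurableSpace α] {μ : Measure α}
    {v h w : α → ℝ≥0∞} (hv : AEMeasurable v μ) (hh : AEMeasurable h μ) (hw : AEMeasurable w μ)
    {a b : ℝ≥0∞} (ha : ∫⁻ x, v x ^ (6 : ℝ) ∂μ ≤ a ^ 3) (hb : ∫⁻ x, w x ^ (6 : ℝ) ∂μ ≤ b ^ 3) :
    (∫⁻ x, v x * h x * w x ∂μ) ^ 4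
      ≤ (∫⁻ x, v x ^ (2 : ℝ) ∂μ) * a * (∫⁻ x, h x ^ (2 : ℝ) ∂μ) ^ 2 * b ^ 2 := by
  -- Here v is split as (v²)^{1/4} (v⁶)^{1/12}; the weights 1/4, 1/12, 1/2, 1/6 add up to 1. The
  -- fourth power turns all exponents in the final bound into integers.
  have key := ENNReal.lintegral_prod_norm_pow_le (μ := μ) (Finset.univ : Finset (Fin 4))
    (f := ![fun x => v x ^ (2 : ℝ), fun x => v x ^ (6 : ℝ), fun x => h x ^ (2 : ℝ),
      fun x => w x ^ (6 : ℝ)]) (p := ![1 / 4, 1 / 12, 1 / 2, 1 / 6])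
    (fun i _ => by fin_cases i <;> simp <;> fun_prop)
    (by simp [Fin.sum_univ_four]; norm_num) (fun i _ => by fin_cases i <;> simp)
  simp only [Fin.prod_univ_four, Matrix.cons_val] at key
  have e : ∀ x, (v x ^ (2 : ℝ)) ^ (1 / 4 : ℝ) * (v x ^ (6 : ℝ)) ^ (1 / 12 : ℝ)
      * (h x ^ (2 : ℝ)) ^ (1 / 2 : ℝ) * (w x ^ (6 : ℝ)) ^ (1 / 6 : ℝ) = v x * h x * w x := by
    intro x
    simp only [← ENNReal.rpow_mul]
    rw [← ENNReal.rpow_add_of_nonneg _ _ (by norm_num) (by norm_num)]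
    norm_num
  simp only [e] at key
  refine (pow_le_pow_left₀ zero_le key 4).trans ?_
  have hpow : ∀ (y : ℝ≥0∞) (r : ℝ), (y ^ r) ^ 4 = y ^ (r * 4) := fun y r => by
    rw [← ENNReal.rpow_natCast, ← ENNReal.rpow_mul]; norm_num
  simp only [mul_pow, hpow]
  have ea : (∫⁻ x, v x ^ (6 : ℝ) ∂μ) ^ (1 / 12 * 4 : ℝ) ≤ a := by
    refine (ENNReal.rpow_le_rpow ha (by norm_num)).trans (le_of_eq ?_)
    rw [← ENNReal.rpow_natCast, ← ENNReal.rpow_mul]; norm_num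
  have eb : (∫⁻ x, w x ^ (6 : ℝ) ∂μ) ^ (1 / 6 * 4 : ℝ) ≤ b ^ 2 := by
    refine (ENNReal.rpow_le_rpow hb (by norm_num)).trans (le_of_eq ?_)
    rw [← ENNReal.rpow_natCast, ← ENNReal.rpow_mul, ← ENNReal.rpow_natCast]; norm_num
  have e1 : ∀ y : ℝ≥0∞, y ^ (1 / 4 * 4 : ℝ) = y := fun y => by norm_num
  have e2 : ∀ y : ℝ≥0∞, y ^ (1 / 2 * 4 : ℝ) = y ^ 2 := fun y => by
    rw [← ENNReal.rpow_natCast]; norm_num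
  rw [e1, e2]
  gcongr

/-- The constant in Sobolev's inequality. -/
abbrev sobolevConst : ℝ := 24 * 104 ^ 2

/-- For H¹ functions integrability of the triple product is itself a consequence of the Sobolev
bound. It is needed to split (v·∇v, w) into nine integrals. -/
lemma abs_integral_mul_mul_pow_four_le {v h w : E3 → ℝ} (hv : IsH1 v) (hv0 : fc v 0 = 0)
    (hh : IsL2 h) (hw : IsH1 w) (hw0 : fc w 0 = 0) {V G H : ℝ}
    (hV : ∫ x in Omega, v x ^ 2 ≤ V) (hG : dirichlet v ≤ G) (hG' : ∫ x in Omega, h x ^ 2 ≤ G)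
    (hH : dirichlet w ≤ H) :
    Integrable (fun x => v x * h x * w x) (volume.restrict Omega) ∧
      |∫ x in Omega, v x * h x * w x| ^ 4 ≤ sobolevConst ^ 3 * V * G ^ 3 * H ^ 2 := by
  have hG0 : 0 ≤ G := (dirichlet_nonneg v).trans hG
  have hH0 : 0 ≤ H := (dirichlet_nonneg w).trans hH
  have hV0 : 0 ≤ V := (integral_nonneg fun _ => sq_nonneg _).trans hV
  have six : ∀ {g : E3 → ℝ} {B : ℝ}, IsH1 g → fc g 0 = 0 → dirichlet g ≤ B →
      ∫⁻ x in Omega, ‖g x‖ₑ ^ (6 : ℝ) ≤ ENNReal.ofReal (sobolevConst * B) ^ 3 := by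
    intro g B hg h0 hB
    have hd := dirichlet_nonneg g
    have e : ∀ x, ‖g x‖ₑ ^ (6 : ℝ) = ENNReal.ofReal (|g x| ^ (6 : ℝ)) := fun x => by
      rw [← ofReal_norm, Real.norm_eq_abs,
        ENNReal.ofReal_rpow_of_nonneg (abs_nonneg _) (by norm_num)]
    simp only [e]
    refine (lintegral_pow_six_le hg h0).trans ?_
    rw [← ENNReal.ofReal_pow (mul_nonneg (by norm_num) (hd.trans hB))]
    refine ENNReal.ofReal_le_ofReal ?_
    gcongr
  have two : ∀ {g : E3 → ℝ} {B : ℝ}, IsL2 g → ∫ x in Omega, g x ^ 2 ≤ B →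
      ∫⁻ x in Omega, ‖g x‖ₑ ^ (2 : ℝ) ≤ ENNReal.ofReal B := by
    intro g B hg hB
    have e : ∀ x, ‖g x‖ₑ ^ (2 : ℝ) = ENNReal.ofReal (g x ^ 2) := fun x => by
      rw [← ofReal_norm, Real.norm_eq_abs,
        ENNReal.ofReal_rpow_of_nonneg (abs_nonneg _) (by norm_num), Real.rpow_two, sq_abs]
    simp only [e]
    rw [← ofReal_integral_eq_lintegral_ofReal hg.integrable_sq
      (Eventually.of_forall fun _ => sq_nonneg _)]
    exact ENNReal.ofReal_le_ofReal hB
  have hmain : (∫⁻ x in Omega, ‖v x * h x * w x‖ₑ) ^ 4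
      ≤ ENNReal.ofReal (sobolevConst ^ 3 * V * G ^ 3 * H ^ 2) := by
    simp only [enorm_mul]
    refine (lintegral_mul_mul_pow_four_le hv.memL2.1.enorm hh.1.enorm hw.memL2.1.enorm
      (six hv hv0 hG) (six hw hw0 hH)).trans ?_
    calc _ ≤ ENNReal.ofReal V * ENNReal.ofReal (sobolevConst * G) * ENNReal.ofReal G ^ 2
          * ENNReal.ofReal (sobolevConst * H) ^ 2 := by
          gcongr
          · exact two hv.memL2 hV
          · exact two hh hG'
      _ = _ := by
          rw [← ENNReal.ofReal_pow hG0, ← ENNReal.ofReal_pow (by positivity),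
            ← ENNReal.ofReal_mul hV0, ← ENNReal.ofReal_mul (by positivity),
            ← ENNReal.ofReal_mul (by positivity)]
          congr 1
          ring
  have hfin : ∫⁻ x in Omega, ‖v x * h x * w x‖ₑ ≠ ⊤ := by
    intro htop
    rw [htop] at hmain
    simp at hmain
  refine ⟨⟨(hv.memL2.1.mul hh.1).mul hw.memL2.1, hfin.lt_top⟩, ?_⟩
  have h1 : ENNReal.ofReal |∫ x in Omega, v x * h x * w x| ≤ ∫⁻ x in Omega, ‖v x * h x * w x‖ₑ := by
    rw [← Real.norm_eq_abs, ofReal_norm]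
    exact enorm_integral_le_lintegral_enorm _
  have h2 := (pow_le_pow_left₀ zero_le h1 4).trans hmain
  rw [← ENNReal.ofReal_pow (abs_nonneg _), ENNReal.ofReal_le_ofReal_iff (by positivity)] at h2
  exact h2

lemma IsSolH1.fc_zero {u : Field} (hu : IsSolH1 u) (j : Fin 3) : fc (u j) 0 = 0 :=
  fc_zero_of_integral_eq_zero (hu.reg j).memL2 (hu.mean j)

/-- The bound of `2 (v·∇v, w)`. -/
lemma two_mul_abs_l2Inner_advect_le {v w : Field} (hv : IsSolH1 v) (hw : IsSolH1 w) {ν : ℝ}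
    (hν : 0 < ν) :
    2 * |l2Inner (advect v v) w|
      ≤ ν / 2 * gradSq v + 2 * 18 ^ 4 * sobolevConst ^ 3 / ν ^ 3 * l2Sq v * gradSq w ^ 2 := by
  set G := gradSq v with hG
  set V := l2Sq v with hV
  set H := gradSq w with hH
  have hG0 : 0 ≤ G := gradSq_nonneg v
  have hH0 : 0 ≤ H := gradSq_nonneg w
  have hV0 : 0 ≤ V := l2Sq_nonneg v
  have hwd : ∀ i j, ∫ x in Omega, wd i (v j) x ^ 2 ≤ G := fun i j =>
    (Finset.single_le_sum (f := fun i => ∫ x in Omega, wd i (v j) x ^ 2)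
      (fun i _ => integral_nonneg fun _ => sq_nonneg _) (Finset.mem_univ i)).trans
      (dirichlet_le_gradSq hv.reg j)
  have hij := fun i j => abs_integral_mul_mul_pow_four_le (hv.reg i) (hv.fc_zero i)
    ((hv.reg j).isL2_wd i) (hw.reg j) (hw.fc_zero j)
    (integral_sq_le_l2Sq (fun j => (hv.reg j).memL2) i) (dirichlet_le_gradSq hv.reg i) (hwd i j)
    (dirichlet_le_gradSq hw.reg j)
  have e : l2Inner (advect v v) w
      = ∑ j, ∑ i, ∫ x in Omega, v i x * wd i (v j) x * w j x := by
    rw [l2Inner]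
    simp only [advect, Finset.sum_mul]
    rw [integral_finsetSum _ fun j _ => integrable_finsetSum _ fun i _ => (hij i j).1]
    exact Finset.sum_congr rfl fun j _ => integral_finsetSum _ fun i _ => (hij i j).1
  set r := ν / 2 * G + 2 * 18 ^ 4 * sobolevConst ^ 3 / ν ^ 3 * V * H ^ 2 with hr
  have hr0 : 0 ≤ r := by positivity
  -- Nine integrals and the factor 2 give 18. As before, Young's inequality is used as 4a³b ≤
  -- (a+b)⁴, with the constant in b adjusted to it.
  have hterm : ∀ i j, |∫ x in Omega, v i x * wd i (v j) x * w j x| ≤ r / 18 := by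
    intro i j
    refine le_of_pow_le_pow_left₀ four_ne_zero (by positivity) ((hij i j).2.trans ?_)
    set a := ν / 2 * G
    set b := 2 * 18 ^ 4 * sobolevConst ^ 3 / ν ^ 3 * V * H ^ 2
    have ha0 : 0 ≤ a := by positivity
    have hb0 : 0 ≤ b := by positivity
    have h1 : 4 * a ^ 3 * b = 18 ^ 4 * (sobolevConst ^ 3 * V * G ^ 3 * H ^ 2) := by
      simp only [a, b]; field_simp; ring
    rw [← hV, ← hG, ← hH, div_pow, le_div_iff₀ (by positivity), mul_comm, ← h1, hr]
    have h2 : (a + b) ^ 4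
        = 4 * a ^ 3 * b + (a ^ 4 + 6 * a ^ 2 * b ^ 2 + 4 * a * b ^ 3 + b ^ 4) := by ring
    rw [h2]
    have : 0 ≤ a ^ 4 + 6 * a ^ 2 * b ^ 2 + 4 * a * b ^ 3 + b ^ 4 := by positivity
    linarith
  have hsum : |l2Inner (advect v v) w| ≤ ∑ _j : Fin 3, ∑ _i : Fin 3, r / 18 := by
    rw [e]
    refine (Finset.abs_sum_le_sum_abs _ _).trans (Finset.sum_le_sum fun j _ => ?_)
    exact (Finset.abs_sum_le_sum_abs _ _).trans (Finset.sum_le_sum fun i _ => hterm i j)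
  simp only [Finset.sum_const, Finset.card_univ, Fintype.card_fin, nsmul_eq_mul] at hsum
  push_cast at hsum
  linarith

theorem exists_isDomainConstants : ∃ c₀ c₄ c₅ : ℝ, IsDomainConstants c₀ c₄ c₅ := by
  have hb := boxVol_pos
  refine ⟨1, 4 * (468 * boxVol⁻¹) ^ 2, 2 * 18 ^ 4 * sobolevConst ^ 3, one_pos, by positivity,
    by positivity, ?_, ?_, ?_, ?_⟩
  · intro u hu hm
    rw [one_mul]
    exact l2Sq_le_gradSq hu hm
  · intro u hu _
    rw [one_mul]
    exact gradSq_le_l2Sq_vlap hu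
  · exact fun u hu ν hν => abs_l2Inner_advect_vlap_le hu hν
  · exact fun v w hv hw ν hν => two_mul_abs_l2Inner_advect_le hv hw hν

/-! ### Estimates for one step of the implicit Euler scheme -/

lemma IsSolH2.isSolH1 {u : Field} (hu : IsSolH2 u) : IsSolH1 u :=
  ⟨fun j => (hu.reg j).memH1, hu.mean, hu.div⟩

lemma IsImplicitEuler.isSolH1 {ν k : ℝ} {fn : ℕ → Field} {u₀ : Field} {u : ℕ → Field}
    (H : IsImplicitEuler ν k fn u₀ u) (hu₀ : IsSolH1 u₀) : ∀ n, IsSolH1 (u n)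
  | 0 => H.init ▸ hu₀
  | n + 1 => (H.sol n).isSolH1

lemma supL2_nonneg (f : ℝ → Field) : 0 ≤ supL2 f :=
  Real.sSup_nonneg (by rintro _ ⟨t, -, rfl⟩; exact Real.sqrt_nonneg _)

lemma supHm1_le {c₀ : ℝ} (hc₀ : 0 ≤ c₀)
    (hP : ∀ u : Field, (∀ j, IsH1 (u j)) → MeanZero u → l2Sq u ≤ c₀ * gradSq u)
    {f : ℝ → Field} (hf : IsForcing f) : supHm1 f ≤ Real.sqrt c₀ * supL2 f := by
  refine Real.sSup_le ?_ (mul_nonneg (Real.sqrt_nonneg _) (supL2_nonneg f))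
  rintro _ ⟨t, ht, rfl⟩
  refine (hm1Norm_le hP hc₀ (hf.sol t ht).reg).trans ?_
  exact mul_le_mul_of_nonneg_left (le_csSup hf.bdd ⟨t, ht, rfl⟩) (Real.sqrt_nonneg _)

lemma sum_mul_fc_sub {u v : Field} (hu : ∀ j, IsL2 (u j)) (hv : ∀ j, IsL2 (v j)) (hdu : DivFree u)
    (hdv : DivFree v) (k : Freq) : ∑ i, (k i : ℂ) * fc (fun x => u i x - v i x) k = 0 := by
  simp only [fun i => fc_sub (hu i) (hv i), mul_sub, Finset.sum_sub_distrib]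
  rw [sum_mul_fc_of_divFree hu hdu, sum_mul_fc_of_divFree hv hdv, sub_zero]

/-- The scheme in weak form, with the pressure eliminated. -/
lemma IsImplicitEuler.inner_eq {ν k : ℝ} {fn : ℕ → Field} {u₀ : Field} {u : ℕ → Field}
    (H : IsImplicitEuler ν k fn u₀ u) (hu₀ : IsSolH1 u₀) (n : ℕ) (hf : IsSolL2 (fn (n + 1)))
    {z : Field} (hz : ∀ j, IsL2 (z j)) (hdiv : ∀ q : Freq, ∑ i, (q i : ℂ) * fc (z i) q = 0) :
    (l2Inner (u (n + 1)) z - l2Inner (u n) z) / k + l2Inner (advect (u (n + 1)) (u (n + 1))) z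
      = ν * l2Inner (vlap (u (n + 1))) z + l2Inner (fn (n + 1)) z := by
  obtain ⟨p, hp, heq⟩ := H.step n
  have hw := H.sol n
  have hwL : ∀ j, IsL2 (u (n + 1) j) := fun j => (hw.reg j).memH1.memL2
  have hvL : ∀ j, IsL2 (u n j) := fun j => ((H.isSolH1 hu₀ n).reg j).memL2
  have hadv := isL2_advect hwL (fun j => (hw.reg j).memH1) hw.ae_abs_le
  have hlap : ∀ j, IsL2 (vlap (u (n + 1)) j) := fun j => isL2_lap (hw.reg j)
  have hp0 := l2Inner_grad_eq_zero hp hz hdiv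
  rw [l2Inner_eq_sum (fun i => hp.isL2_wd i) hz] at hp0
  rw [l2Inner_eq_sum hwL hz, l2Inner_eq_sum hvL hz, l2Inner_eq_sum hadv hz, l2Inner_eq_sum hlap hz,
    l2Inner_eq_sum hf.reg hz, ← Finset.sum_sub_distrib, Finset.sum_div, Finset.mul_sum,
    -- The vanishing pressure term is inserted as a zero, so that the scheme can be integrated
    -- component by component.
    ← Finset.sum_add_distrib, ← Finset.sum_add_distrib, ← add_zero (Finset.sum _ _), ← hp0,
    ← Finset.sum_add_distrib]
  refine Finset.sum_congr rfl fun j _ => ?_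
  have i1 := (hwL j).integrable_mul (hz j)
  have i2 := (hvL j).integrable_mul (hz j)
  have i3 := (hadv j).integrable_mul (hz j)
  have i4 := (hp.isL2_wd j).integrable_mul (hz j)
  have i12 : Integrable (fun x => (u (n + 1) j x * z j x - u n j x * z j x) / k)
    (volume.restrict Omega) := (i1.sub i2).div_const k
  have i123 : Integrable (fun x => (u (n + 1) j x * z j x - u n j x * z j x) / k
    + advect (u (n + 1)) (u (n + 1)) j x * z j x) (volume.restrict Omega) := i12.add i3
  rw [← integral_sub i1 i2, ← integral_div, ← integral_add i12 i3, ← integral_add i123 i4,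
    ← integral_const_mul, ← integral_add (((hlap j).integrable_mul (hz j)).const_mul ν)
      ((hf.reg j).integrable_mul (hz j))]
  refine integral_congr_ae ?_
  filter_upwards [heq j] with x hx
  linear_combination z j x * hx

/-- The energy, enstrophy and growth estimates for one step. -/
lemma IsImplicitEuler.step_estimates {c₀ c₄ c₅ : ℝ} (hc : IsDomainConstants c₀ c₄ c₅) {ν k : ℝ}
    (hν : 0 < ν) (hk : 0 < k) {u₀ : Field} (hu₀ : IsSolH1 u₀) {f : ℝ → Field}
    {fn : ℕ → Field} (hfn : IsDiscreteForcing f fn) {u : ℕ → Field}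
    (H : IsImplicitEuler ν k fn u₀ u) (n : ℕ) :
    (∃ D, 0 ≤ D ∧ gradSq (u (n + 1)) ≤ c₀ * D ∧
      gradSq (u (n + 1)) - gradSq (u n)
        ≤ k * (c₄ / ν ^ 3 * gradSq (u (n + 1)) ^ 3 - ν * D + 2 * supL2 f * Real.sqrt D)) ∧
    l2Sq (u (n + 1)) - l2Sq (u n)
      ≤ k * (-2 * ν * gradSq (u (n + 1)) + 2 * supHm1 f * Real.sqrt (gradSq (u (n + 1)))) ∧
    gradSq (u (n + 1)) ≤ 2 * (gradSq (u n) + c₅ / ν ^ 4 * l2Sq (u (n + 1)) * gradSq (u n) ^ 2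
      + supHm1 f ^ 2 / ν ^ 2) := by
  have hw := H.sol n
  have hv := H.isSolH1 hu₀ n
  have hf := hfn.sol (n + 1) (by omega)
  have hF := hfn.l2_le (n + 1) (by omega)
  have hFm := hfn.hm1_le (n + 1) (by omega)
  have hin := fun {z : Field} => H.inner_eq hu₀ n hf (z := z)
  set w := u (n + 1)
  set v := u n
  set g := fn (n + 1)
  have hw1 : ∀ j, IsH1 (w j) := fun j => (hw.reg j).memH1
  have hwL : ∀ j, IsL2 (w j) := fun j => (hw1 j).memL2
  have hvL : ∀ j, IsL2 (v j) := fun j => (hv.reg j).memL2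
  have hlap : ∀ j, IsL2 (vlap w j) := fun j => isL2_lap (hw.reg j)
  have hadv := isL2_advect hwL hw1 hw.ae_abs_le
  have hb0 : l2Inner (advect w w) w = 0 := l2Inner_advect_self hw1 hw.div hw.ae_abs_le
  have hgs := gradSq_sub hw1 hv.reg
  have hww : l2Inner w (vlap w) = -gradSq w := by
    rw [l2Inner_vlap hw1 hw.reg, gradSq_eq_gradInner]
  have hvw : l2Inner v (vlap w) = -gradInner v w := l2Inner_vlap hv.reg hw.reg
  have hd0 := gradSq_nonneg (fun j x => w j x - v j x)
  have hmul : ∀ {x y : ℝ}, x / k = y → x = k * y := fun h => by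
    rw [← h, mul_div_cancel₀ _ hk.ne']
  refine ⟨⟨l2Sq (vlap w), l2Sq_nonneg _, hc.poincare' w hw.reg hw.mean, ?_⟩, ?_, ?_⟩
  -- Test with Δw. The growth of |∇·|² is at most twice |∇w|² - (∇v, ∇w), as |∇(w - v)|² ≥ 0.
  · have h1 := hin hlap (sum_mul_fc_vlap hw.reg hw.div)
    rw [hww, hvw, ← l2Sq_eq_l2Inner] at h1
    have h2 := hc.bound₄ w hw ν hν
    have h3 := abs_l2Inner_le hf.reg hlap
    have h4 : Real.sqrt (l2Sq g) * Real.sqrt (l2Sq (vlap w))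
        ≤ supL2 f * Real.sqrt (l2Sq (vlap w)) :=
      mul_le_mul_of_nonneg_right hF (Real.sqrt_nonneg _)
    have h5 := le_of_abs_le h2
    have h6 := neg_le_of_abs_le h3
    have h7 := hmul (eq_sub_of_add_eq h1)
    have h8 : c₄ / (2 * ν ^ 3) * gradSq w ^ 3 = c₄ / ν ^ 3 * gradSq w ^ 3 / 2 := by
      field_simp
    have h9 : gradSq w - gradInner v w ≤ k * (c₄ / ν ^ 3 * gradSq w ^ 3 / 2
        - ν / 2 * l2Sq (vlap w) + supL2 f * Real.sqrt (l2Sq (vlap w))) := by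
      have e : gradSq w - gradInner v w = k * (l2Inner (advect w w) (vlap w)
        - ν * l2Sq (vlap w) - l2Inner g (vlap w)) := by linarith
      rw [e]
      refine mul_le_mul_of_nonneg_left ?_ hk.le
      linarith
    linarith
  -- Test with w; the advection term vanishes.
  · have h1 := hin hwL (sum_mul_fc_of_divFree hwL hw.div)
    rw [hb0, add_zero, l2Inner_comm (vlap w), hww, ← l2Sq_eq_l2Inner] at h1
    have h2 := hmul h1
    have h3 := l2Inner_le_hm1Norm hc.poincare hf.reg hw1 hw.mean
    have h4 : hm1Norm g * Real.sqrt (gradSq w) ≤ supHm1 f * Real.sqrt (gradSq w) :=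
      mul_le_mul_of_nonneg_right hFm (Real.sqrt_nonneg _)
    have h5 : 2 * l2Inner v w ≤ l2Sq w + l2Sq v := by
      have h6 := abs_l2Inner_le hvL hwL
      have h7 := le_of_abs_le h6
      have h8 := Real.sq_sqrt (l2Sq_nonneg v)
      have h9 := Real.sq_sqrt (l2Sq_nonneg w)
      nlinarith [sq_nonneg (Real.sqrt (l2Sq v) - Real.sqrt (l2Sq w))]
    have h10 : k * (ν * -gradSq w + l2Inner g w)
        ≤ k * (ν * -gradSq w + supHm1 f * Real.sqrt (gradSq w)) :=
      mul_le_mul_of_nonneg_left (by linarith) hk.le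
    linarith
  -- Test with w - v. The term |w - v|²/k has a good sign, so k drops out, and (w·∇w, w - v) =
  -- -(w·∇w, v) involves the gradient of w only through the quadratic term in `bound₅`, which is
  -- absorbed.
  · have hδ : ∀ j, IsH1 (fun x => w j x - v j x) := fun j => (hw1 j).sub (hv.reg j)
    have hδL : ∀ j, IsL2 (fun x => w j x - v j x) := fun j => (hδ j).memL2
    have hδm : MeanZero (fun j x => w j x - v j x) := fun j => by
      rw [integral_sub ((hwL j).integrable one_le_two) ((hvL j).integrable one_le_two),
        hw.mean j, hv.mean j, sub_zero]
    have h1 := hin hδL (sum_mul_fc_sub hwL hvL hw.div hv.div)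
    rw [← l2Inner_sub_left hwL hvL hδL, ← l2Sq_eq_l2Inner,
      l2Inner_comm (advect w w), l2Inner_comm (vlap w), l2Inner_sub_left hwL hvL hadv,
      l2Inner_sub_left hwL hvL hlap, hww, hvw, l2Inner_comm w, hb0, l2Inner_comm v] at h1
    have h2 : 0 ≤ l2Sq (fun j x => w j x - v j x) / k := div_nonneg (l2Sq_nonneg _) hk.le
    have h3 := l2Inner_le_hm1Norm hc.poincare hf.reg hδ hδm
    have h4 := hc.bound₅ w v hw.isSolH1 hv ν hν
    have h5 := le_abs_self (l2Inner (advect w w) v)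
    set d := Real.sqrt (gradSq fun j x => w j x - v j x) with hd
    have hdd : d ^ 2 = gradSq w - 2 * gradInner v w + gradSq v := by
      rw [hd, Real.sq_sqrt hd0, hgs]
    have h6 : hm1Norm g * d ≤ supHm1 f * d := mul_le_mul_of_nonneg_right hFm (Real.sqrt_nonneg _)
    -- With the weight ν on d² the mixed term (∇v, ∇w) cancels exactly.
    have h7 : 2 * (supHm1 f * d) ≤ ν * d ^ 2 + supHm1 f ^ 2 / ν := by
      have : ν * d ^ 2 + supHm1 f ^ 2 / ν - 2 * (supHm1 f * d) = (ν * d - supHm1 f) ^ 2 / ν := by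
        field_simp; ring
      have h8 : 0 ≤ (ν * d - supHm1 f) ^ 2 / ν := by positivity
      linarith
    have h9 : ν / 2 * gradSq w
        ≤ ν * gradSq v + c₅ / ν ^ 3 * l2Sq w * gradSq v ^ 2 + supHm1 f ^ 2 / ν := by
      rw [hdd] at h7
      linarith
    have e : 2 * (gradSq v + c₅ / ν ^ 4 * l2Sq w * gradSq v ^ 2 + supHm1 f ^ 2 / ν ^ 2)
        = (2 / ν) * (ν * gradSq v + c₅ / ν ^ 3 * l2Sq w * gradSq v ^ 2 + supHm1 f ^ 2 / ν) := by
      field_simp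
    rw [e]
    have := mul_le_mul_of_nonneg_left h9 (by positivity : 0 ≤ 2 / ν)
    calc gradSq w = 2 / ν * (ν / 2 * gradSq w) := by field_simp
      _ ≤ _ := this

/-! ### Scalar recursions -/

/-- `y - μ y³` is strictly increasing below the point where `μ y² = 1/3`. -/
lemma mul_cube_sub_cube_lt {μ x y : ℝ} (hμ : 0 < μ) (hy : 0 ≤ y) (hyx : y < x)
    (hx : μ * x ^ 2 ≤ 1 / 3) : μ * (x ^ 3 - y ^ 3) < x - y := by
  have h1 : x ^ 2 + x * y + y ^ 2 < 3 * x ^ 2 := by nlinarith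
  have h2 : μ * (x ^ 2 + x * y + y ^ 2) < 1 := by nlinarith
  have e : μ * (x ^ 3 - y ^ 3) = (x - y) * (μ * (x ^ 2 + x * y + y ^ 2)) := by ring
  rw [e]
  nlinarith [sub_pos.2 hyx]

/-- Short-time bound for the implicit Euler discretization of `a' ≤ κ (a³ + β³)`. -/
lemma short_time_bound {a : ℕ → ℝ} {κ k β : ℝ} (hκ : 0 < κ) (hk : 0 < k) (hβ : 0 ≤ β)
    (ha : ∀ n, 0 ≤ a n)
    (hstep : ∀ n, a (n + 1) - a n ≤ k * (κ * a (n + 1) ^ 3 + κ * β ^ 3))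
    (hstab : ∀ n, a n ≤ 2 * a 0 + β → κ * k * a (n + 1) ^ 2 ≤ 1 / 3) (n : ℕ)
    (hn : κ * (n * k) * ((2 * a 0 + β) ^ 3 + β ^ 3) ≤ a 0 + β) :
    a n ≤ a 0 + κ * (n * k) * ((2 * a 0 + β) ^ 3 + β ^ 3) := by
  set X := 2 * a 0 + β with hX
  have hX0 : 0 ≤ X := by have := ha 0; positivity
  induction n with
  | zero => simp
  | succ n ih =>
    have hinc : κ * ((n + 1 : ℕ) * k) * (X ^ 3 + β ^ 3)
        = κ * (n * k) * (X ^ 3 + β ^ 3) + κ * k * (X ^ 3 + β ^ 3) := by push_cast; ring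
    have hpos : 0 ≤ κ * k * (X ^ 3 + β ^ 3) := by positivity
    have hpos' : 0 ≤ κ * (n * k) * (X ^ 3 + β ^ 3) := by positivity
    have hn' := ih (by linarith)
    have hst := hstab n (by linarith)
    by_contra! hlt
    set b := a 0 + κ * ((n + 1 : ℕ) * k) * (X ^ 3 + β ^ 3) with hb
    have hb0 : 0 ≤ b := by have := ha 0; linarith
    have hbX : b ≤ X := by linarith
    -- The barrier b exceeds its previous value by κk(X³ + β³) ≥ κk(b³ + β³). If a (n+1) were larger
    -- than b, monotonicity of y - κk y³ would contradict `hstep`.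
    have h1 := mul_cube_sub_cube_lt (mul_pos hκ hk) hb0 hlt hst
    have h2 := hstep n
    have h3 : κ * k * b ^ 3 ≤ κ * k * X ^ 3 := by gcongr
    linarith

lemma global_bound_of_sq_le {x : ℕ → ℝ} {r h : ℝ} (hr : 0 ≤ r) (hh : 0 < h) (hh1 : h ≤ 1)
    (hx : ∀ n, 0 ≤ x n) (hsmall : x 0 + 2 * r ^ 2 ≤ 1) (hq : r ^ 2 ≤ 1 / 8)
    (hA : ∀ n, ∃ d, 0 ≤ d ∧ x (n + 1) ≤ d ^ 2 ∧
      x (n + 1) - x n ≤ h * (x (n + 1) ^ 3 / 4 - d ^ 2 + 2 * r * d))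
    (hstab : ∀ n, x n ≤ x 0 + 10 * r ^ 2 → h * x (n + 1) ^ 2 ≤ 4 / 3) (n : ℕ) :
    x n ≤ x 0 + 10 * r ^ 2 := by
  have hx0 := hx 0
  set M := max (x 0) (8 * r ^ 2) with hM
  have hM1 : M ≤ 1 := max_le (by nlinarith) (by linarith)
  have hMT : M ≤ x 0 + 10 * r ^ 2 := max_le (by nlinarith) (by nlinarith)
  have hM8 : 8 * r ^ 2 ≤ M := le_max_right _ _
  suffices hall : x n ≤ M from hall.trans hMT
  induction n with
  | zero => exact le_max_left _ _
  | succ n ih =>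
    obtain ⟨d, hd0, hxd, hstep⟩ := hA n
    have hst := hstab n (ih.trans hMT)
    set y := x (n + 1)
    -- For y > 1 the increment would be at most h(y² + y)/4 times y - 1, and the timestep
    -- restriction makes that factor at most 2/3.
    have hy1 : y ≤ 1 := by
      by_contra! hy
      have hd1 : 1 ≤ d := by nlinarith
      have hr1 : 2 * r ≤ 3 / 4 := by nlinarith
      have h1 : 2 * r * d ≤ 3 / 4 * d ^ 2 := by nlinarith
      have h2 : h * (y ^ 3 / 4 - d ^ 2 + 2 * r * d) ≤ h * (y ^ 3 / 4 - y / 4) :=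
        mul_le_mul_of_nonneg_left (by linarith) hh.le
      have h3 : y - 1 ≤ h * (y ^ 3 / 4 - y / 4) := by linarith
      have e1 : h * (y ^ 3 / 4 - y / 4) = (y - 1) * (h * (y ^ 2 + y) / 4) := by ring
      have h4 : h * (y ^ 2 + y) / 4 ≤ 2 / 3 := by nlinarith
      rw [e1] at h3
      nlinarith
    by_contra! hlt
    have h1 : 2 * r * d ≤ d ^ 2 / 2 + 2 * r ^ 2 := by nlinarith [sq_nonneg (d - 2 * r)]
    have h2 : y ^ 3 ≤ y := by
      have : y ^ 2 ≤ 1 := pow_le_one₀ (hx _) hy1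
      nlinarith [hx (n + 1)]
    have h3 : h * (y ^ 3 / 4 - d ^ 2 + 2 * r * d) ≤ h * 0 :=
      mul_le_mul_of_nonneg_left (by linarith) hh.le
    linarith

/-- For strong forces the enstrophy inequality may provide no barrier: at r² = 1/2 and d = √y its
right side is nonnegative for all y ≥ 0. The energy inequality adds dissipation; the combination x +
(5/4)e stays below 1 + (5/4)E, where E is the barrier of e alone. -/
lemma global_bound_of_lt_sq {x e : ℕ → ℝ} {r h : ℝ} (hr : 0 ≤ r) (hh : 0 < h)
    (hx : ∀ n, 0 ≤ x n) (hex : ∀ n, e n ≤ x n) (he0 : ∀ n, 0 ≤ e n)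
    (hsmall : x 0 + 2 * r ^ 2 ≤ 1) (hq : 1 / 8 < r ^ 2)
    (hA : ∀ n, ∃ d, 0 ≤ d ∧ x (n + 1) ≤ d ^ 2 ∧
      x (n + 1) - x n ≤ h * (x (n + 1) ^ 3 / 4 - d ^ 2 + 2 * r * d))
    (hB : ∀ n, e (n + 1) - e n ≤ h * (-2 * x (n + 1) + 2 * r * Real.sqrt (x (n + 1))))
    (hstab : ∀ n, x n ≤ x 0 + 10 * r ^ 2 → h * x (n + 1) ^ 2 ≤ 4 / 3) (n : ℕ) :
    x n ≤ x 0 + 10 * r ^ 2 := by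
  have hx0 := hx 0
  set E := max (x 0) (r ^ 2) with hE
  have hxE : x 0 ≤ E := le_max_left _ _
  have hrE : r ^ 2 ≤ E := le_max_right _ _
  have hr1 : r ≤ 1 := by nlinarith
  have hY2 : 1 + 5 / 4 * E ≤ 2 := by
    have : E ≤ 4 / 5 := max_le (by linarith) (by linarith)
    linarith
  have hYT : 1 + 5 / 4 * E ≤ x 0 + 10 * r ^ 2 := by
    rcases max_cases (x 0) (r ^ 2) with ⟨h1, -⟩ | ⟨h1, -⟩ <;> rw [← hE] at h1 <;> linarith
  suffices hall : e n ≤ E ∧ x n + 5 / 4 * e n ≤ 1 + 5 / 4 * E by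
    have := he0 n
    linarith [hall.2]
  induction n with
  | zero =>
    have := hex 0
    exact ⟨by linarith, by linarith⟩
  | succ n ih =>
    obtain ⟨ih1, ih2⟩ := ih
    obtain ⟨d, hd0, hxd, hstep⟩ := hA n
    have hst := hstab n (by have := he0 n; linarith)
    have hen := hB n
    have hey := hex (n + 1)
    have he1 := he0 (n + 1)
    set y := x (n + 1)
    set s := Real.sqrt y with hs
    have hs0 : 0 ≤ s := Real.sqrt_nonneg _
    have hss : s ^ 2 = y := Real.sq_sqrt (hx _)
    have hE1 : e (n + 1) ≤ E := by
      by_contra! hlt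
      have h1 : r ≤ s := by
        refine le_of_pow_le_pow_left₀ two_ne_zero hs0 ?_
        linarith
      have h2 : -2 * y + 2 * r * s ≤ 0 := by nlinarith
      have h3 : h * (-2 * y + 2 * r * s) ≤ 0 := mul_nonpos_of_nonneg_of_nonpos hh.le h2
      linarith
    refine ⟨hE1, ?_⟩
    rcases le_or_gt y 1 with hy | hy
    · linarith
    have hs1 : 1 ≤ s := by nlinarith
    have hsd : s ≤ d := le_of_pow_le_pow_left₀ two_ne_zero hd0 (by linarith)
    have hdec : -d ^ 2 + 2 * r * d ≤ -y + 2 * r * s := by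
      have h1 := mul_nonneg (sub_nonneg.2 hsd) (by linarith : 0 ≤ d + s - 2 * r)
      have e1 : (d - s) * (d + s - 2 * r) = d ^ 2 - s ^ 2 - 2 * r * d + 2 * r * s := by ring
      linarith
    -- Young's inequality with r² ≤ 1/2, weighted so that the cubic in `hR` is negative on [1, 2].
    have hrs : r * s ≤ 35 / 100 * y + 5 / 14 := by
      have h1 := sq_nonneg (r - 7 / 10 * s)
      have e1 : (r - 7 / 10 * s) ^ 2 = r ^ 2 - 7 / 5 * (r * s) + 49 / 100 * s ^ 2 := by ring
      linarith
    have hR : y ^ 3 / 4 - d ^ 2 + 2 * r * d + 5 / 4 * (-2 * y + 2 * r * s)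
        ≤ y ^ 3 / 4 - 77 / 40 * y + 45 / 28 := by linarith
    have hsum : y + 5 / 4 * e (n + 1) - (x n + 5 / 4 * e n)
        ≤ h * (y ^ 3 / 4 - 77 / 40 * y + 45 / 28) := by
      have := mul_le_mul_of_nonneg_left hR hh.le
      linarith
    -- The previous value of x + (5/4)e is at most 2, and h y² ≤ 4/3 keeps the slope of the cubic
    -- below 1/h, so y cannot jump past 2.
    have hy2 : y ≤ 2 := by
      by_contra! hy2
      have h1 : y - 2 ≤ h * (y ^ 3 / 4 - 77 / 40 * y + 45 / 28) := by linarith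
      have h2 : y ^ 3 / 4 - 77 / 40 * y + 45 / 28
          ≤ (y - 2) * ((y ^ 2 + 2 * y + 4) / 4 - 77 / 40) := by linarith
      have h3 : (y ^ 2 + 2 * y + 4) / 4 - 77 / 40 ≤ 3 / 4 * y ^ 2 - 77 / 40 := by
        have := mul_nonneg (sub_nonneg.2 hy2.le) (by linarith : 0 ≤ y + 1)
        linarith
      have h4 : h * ((y ^ 2 + 2 * y + 4) / 4 - 77 / 40) < 1 := by
        have := mul_le_mul_of_nonneg_left h3 hh.le
        linarith
      have h5 := mul_le_mul_of_nonneg_left h2 hh.le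
      have h6 : h * ((y - 2) * ((y ^ 2 + 2 * y + 4) / 4 - 77 / 40))
          = (y - 2) * (h * ((y ^ 2 + 2 * y + 4) / 4 - 77 / 40)) := by ring
      have h7 := mul_lt_mul_of_pos_left h4 (sub_pos.2 hy2)
      linarith
    have hneg : y ^ 3 / 4 - 77 / 40 * y + 45 / 28 ≤ 0 := by
      have h1 := mul_nonneg (mul_nonneg (sub_nonneg.2 hy.le) (sub_nonneg.2 hy2))
        (by linarith : 0 ≤ y + 3)
      -- On [1, 2] the cube lies below its chord 7y - 6.
      have e1 : (y - 1) * (2 - y) * (y + 3) = 7 * y - 6 - y ^ 3 := by ring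
      linarith
    have := mul_nonpos_of_nonneg_of_nonpos hh.le hneg
    linarith

/-- A bound for all times for the implicit Euler discretization of the coupled inequalities
`x' ≤ x³/4 - d² + 2 r d`, `x ≤ d²` and `e' ≤ -2x + 2 r √x`, `e ≤ x`. -/
lemma global_bound {x e : ℕ → ℝ} {r h : ℝ} (hr : 0 ≤ r) (hh : 0 < h) (hh1 : h ≤ 1)
    (hx : ∀ n, 0 ≤ x n) (hex : ∀ n, e n ≤ x n) (he0 : ∀ n, 0 ≤ e n)
    (hsmall : x 0 + 2 * r ^ 2 ≤ 1)
    (hA : ∀ n, ∃ d, 0 ≤ d ∧ x (n + 1) ≤ d ^ 2 ∧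
      x (n + 1) - x n ≤ h * (x (n + 1) ^ 3 / 4 - d ^ 2 + 2 * r * d))
    (hB : ∀ n, e (n + 1) - e n ≤ h * (-2 * x (n + 1) + 2 * r * Real.sqrt (x (n + 1))))
    (hstab : ∀ n, x n ≤ x 0 + 10 * r ^ 2 → h * x (n + 1) ^ 2 ≤ 4 / 3) (n : ℕ) :
    x n ≤ x 0 + 10 * r ^ 2 := by
  rcases le_or_gt (r ^ 2) (1 / 8) with hq | hq
  · exact global_bound_of_sq_le hr hh hh1 hx hsmall hq hA hstab n
  · exact global_bound_of_lt_sq hr hh hx hex he0 hsmall hq hA hB hstab n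

/-! ### Uniform bounds for the scheme -/

section Scheme

variable {c₀ c₄ c₅ ν k : ℝ} {u₀ : Field} {f : ℝ → Field} {fn : ℕ → Field} {u : ℕ → Field}

/-- The energy bound. -/
lemma IsImplicitEuler.l2Sq_le (hc : IsDomainConstants c₀ c₄ c₅) (hν : 0 < ν) (hk : 0 < k)
    (hu₀ : IsSolH1 u₀) (hfn : IsDiscreteForcing f fn) (H : IsImplicitEuler ν k fn u₀ u) (n : ℕ) :
    l2Sq (u n) ≤ K0t c₀ ν u₀ f := by
  have h0 := hc.pos₀
  -- Half of the force term already suffices: above this level the Poincaré inequality makes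
  -- viscosity dominate the force, so the energy cannot grow.
  have hB : l2Sq u₀ + c₀ / ν ^ 2 * supHm1 f ^ 2 ≤ K0t c₀ ν u₀ f := by
    have : 0 ≤ c₀ / ν ^ 2 * supHm1 f ^ 2 := by positivity
    have e : K0t c₀ ν u₀ f = l2Sq u₀ + 2 * (c₀ / ν ^ 2 * supHm1 f ^ 2) := by rw [K0t]; ring
    linarith
  refine le_trans ?_ hB
  induction n with
  | zero =>
    rw [H.init]
    have : 0 ≤ c₀ / ν ^ 2 * supHm1 f ^ 2 := by positivity
    linarith
  | succ n ih =>
    have hs := (H.step_estimates hc hν hk hu₀ hfn n).2.1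
    have hP := hc.poincare _ (H.isSolH1 hu₀ (n + 1)).reg (H.isSolH1 hu₀ (n + 1)).mean
    set a := gradSq (u (n + 1))
    have ha : 0 ≤ a := gradSq_nonneg _
    by_contra! hlt
    have h1 : c₀ / ν ^ 2 * supHm1 f ^ 2 < c₀ * a := by
      have := l2Sq_nonneg u₀
      linarith
    have h2 : supHm1 f ^ 2 / ν ^ 2 < a := by
      refine lt_of_mul_lt_mul_left (a := c₀) ?_ h0.le
      calc c₀ * (supHm1 f ^ 2 / ν ^ 2) = c₀ / ν ^ 2 * supHm1 f ^ 2 := by ring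
        _ < c₀ * a := h1
    rw [div_lt_iff₀ (by positivity)] at h2
    have h3 : supHm1 f * Real.sqrt a ≤ ν * a := by
      refine (le_abs_self _).trans (abs_le_of_sq_le_sq ?_ (by positivity))
      rw [mul_pow, Real.sq_sqrt ha]
      calc supHm1 f ^ 2 * a ≤ (a * ν ^ 2) * a := mul_le_mul_of_nonneg_right h2.le ha
        _ = (ν * a) ^ 2 := by ring
    have h4 : k * (-2 * ν * a + 2 * supHm1 f * Real.sqrt a) ≤ 0 :=
      mul_nonpos_of_nonneg_of_nonpos hk.le (by linarith)
    linarith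

/-- Under the timestep restriction one step cannot leave the monotone branch of the cubic. -/
lemma IsImplicitEuler.mul_gradSq_sq_le (hc : IsDomainConstants c₀ c₄ c₅) (hν : 0 < ν) (hk : 0 < k)
    (hu₀ : IsSolH1 u₀) (hfn : IsDiscreteForcing f fn) (H : IsImplicitEuler ν k fn u₀ u) {K : ℝ}
    (hK : StepRestriction c₀ c₄ c₅ ν k u₀ f K) {n : ℕ} (hn : gradSq (u n) ≤ K) :
    c₄ / ν ^ 3 * k * gradSq (u (n + 1)) ^ 2 ≤ 1 / 3 := by
  have h4 := hc.pos₄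
  have h5 := hc.pos₅
  have hs := (H.step_estimates hc hν hk hu₀ hfn n).2.2
  have hE := H.l2Sq_le hc hν hk hu₀ hfn (n + 1)
  have hE0 := l2Sq_nonneg (u (n + 1))
  have ha0 := gradSq_nonneg (u n)
  have ha : 0 ≤ gradSq (u (n + 1)) := gradSq_nonneg _
  have h1 : gradSq (u n) + c₅ / ν ^ 4 * l2Sq (u (n + 1)) * gradSq (u n) ^ 2
      ≤ K + c₅ / ν ^ 4 * K0t c₀ ν u₀ f * K ^ 2 := by
    have hK0 := ha0.trans hn
    have hE1 := hE0.trans hE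
    gcongr
  -- The right side equals (ν³/(3c₄k))^{1/2}, the turning point of y - c₄kν⁻³y³.
  have h2 : gradSq (u (n + 1)) ≤ 2 * Real.sqrt (ν ^ 3 / (12 * c₄ * k)) := by
    have := hK.second
    have e : (1 + c₅ / ν ^ 4 * K0t c₀ ν u₀ f * K) * K = K + c₅ / ν ^ 4 * K0t c₀ ν u₀ f * K ^ 2 := by
      ring
    linarith
  have h3 := pow_le_pow_left₀ ha h2 2
  rw [mul_pow, Real.sq_sqrt (by positivity)] at h3
  calc c₄ / ν ^ 3 * k * gradSq (u (n + 1)) ^ 2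
      ≤ c₄ / ν ^ 3 * k * (2 ^ 2 * (ν ^ 3 / (12 * c₄ * k))) :=
        mul_le_mul_of_nonneg_left h3 (by positivity)
    _ = 1 / 3 := by field_simp; norm_num

lemma IsImplicitEuler.gradSq_le_short (hc : IsDomainConstants c₀ c₄ c₅) (hν : 0 < ν) (hk : 0 < k)
    (hu₀ : IsSolH1 u₀) (hfn : IsDiscreteForcing f fn) (H : IsImplicitEuler ν k fn u₀ u)
    (hK : StepRestriction c₀ c₄ c₅ ν k u₀ f (Kt c₀ c₄ ν u₀ f)) {n : ℕ}
    (hn : c₄ / ν ^ 3 * (n * k) * (8 * (gradSq u₀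
      + (2 * ν ^ 2 * supL2 f ^ 2 / c₄) ^ (1 / 3 : ℝ)) ^ 2) ≤ 1) :
    gradSq (u n) ≤ 2 * gradSq u₀ + (ν ^ 2 * supL2 f ^ 2 / c₄) ^ (1 / 3 : ℝ) := by
  have h0 := hc.pos₀
  have h4 := hc.pos₄
  set F := supL2 f
  set β := (ν ^ 2 * F ^ 2 / c₄) ^ (1 / 3 : ℝ) with hβ
  have hbase : 0 ≤ ν ^ 2 * F ^ 2 / c₄ := by positivity
  have hβ0 : 0 ≤ β := Real.rpow_nonneg hbase _
  have hβ3 : β ^ 3 = ν ^ 2 * F ^ 2 / c₄ := by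
    rw [hβ, ← Real.rpow_natCast, ← Real.rpow_mul hbase]; norm_num
  set P := (2 * ν ^ 2 * F ^ 2 / c₄) ^ (1 / 3 : ℝ)
  have hP : β ≤ P := by
    refine Real.rpow_le_rpow hbase ?_ (by norm_num)
    rw [show 2 * ν ^ 2 * F ^ 2 / c₄ = 2 * (ν ^ 2 * F ^ 2 / c₄) by ring]
    linarith
  set κ := c₄ / ν ^ 3 with hκ
  have hκ0 : 0 < κ := by positivity
  -- β is chosen so that κβ³ is the maximum F²/ν of -νD + 2F√D over D.
  have hκβ : κ * β ^ 3 = F ^ 2 / ν := by rw [hβ3, hκ]; field_simp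
  have ha0 : 0 ≤ gradSq u₀ := gradSq_nonneg _
  have hstep : ∀ m, gradSq (u (m + 1)) - gradSq (u m)
      ≤ k * (κ * gradSq (u (m + 1)) ^ 3 + κ * β ^ 3) := by
    intro m
    obtain ⟨D, hD0, -, hD⟩ := (H.step_estimates hc hν hk hu₀ hfn m).1
    refine hD.trans (mul_le_mul_of_nonneg_left ?_ hk.le)
    have hs := Real.sq_sqrt hD0
    have h1 : F ^ 2 / ν + ν * D - 2 * F * Real.sqrt D = (F - ν * Real.sqrt D) ^ 2 / ν := by
      field_simp
      linear_combination (-ν ^ 2) * hs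
    have h2 : 0 ≤ (F - ν * Real.sqrt D) ^ 2 / ν := by positivity
    linarith
  have hKX : 2 * gradSq u₀ + β ≤ Kt c₀ c₄ ν u₀ f := by
    have : 0 ≤ 10 * c₀ * min (1 / ν) (1 / ν ^ 2) * F ^ 2 := by positivity
    rw [Kt]
    linarith
  -- Up to the stated time the linear barrier then gains at most |∇u₀|² + β, which produces the
  -- factor 8 in the bound of the time.
  have hcub : (2 * gradSq u₀ + β) ^ 3 + β ^ 3 ≤ (gradSq u₀ + β) * (8 * (gradSq u₀ + P) ^ 2) := by
    have h1 : (gradSq u₀ + β) ^ 2 ≤ (gradSq u₀ + P) ^ 2 := by gcongr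
    calc (2 * gradSq u₀ + β) ^ 3 + β ^ 3
        ≤ (2 * gradSq u₀ + β) ^ 3 + β ^ 3 + (gradSq u₀ + β) * (12 * gradSq u₀ * β + 6 * β ^ 2) := by
          have : 0 ≤ (gradSq u₀ + β) * (12 * gradSq u₀ * β + 6 * β ^ 2) := by positivity
          linarith
      _ = (gradSq u₀ + β) * (8 * (gradSq u₀ + β) ^ 2) := by ring
      _ ≤ _ := by gcongr
  have hcond : κ * (n * k) * ((2 * gradSq u₀ + β) ^ 3 + β ^ 3) ≤ gradSq u₀ + β := by
    calc κ * (n * k) * ((2 * gradSq u₀ + β) ^ 3 + β ^ 3)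
        ≤ κ * (n * k) * ((gradSq u₀ + β) * (8 * (gradSq u₀ + P) ^ 2)) := by gcongr
      _ = (gradSq u₀ + β) * (κ * (n * k) * (8 * (gradSq u₀ + P) ^ 2)) := by ring
      _ ≤ (gradSq u₀ + β) * 1 := mul_le_mul_of_nonneg_left hn (by positivity)
      _ = _ := mul_one _
  have key := short_time_bound (a := fun m => gradSq (u m)) hκ0 hk hβ0 (fun m => gradSq_nonneg _)
    hstep (fun m hm => H.mul_gradSq_sq_le hc hν hk hu₀ hfn hK
      (hm.trans (by simpa only [H.init] using hKX))) n
  simp only [H.init] at key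
  have := key hcond
  linarith

/-- Scaling: enstrophy in units of the threshold S, energy in units of c₀S, time in units of c₀/ν.
As c₄ν⁻³S² = ν/(4c₀), the cubic gets the coefficient 1/4, the smallness condition becomes x₀ + 2r² ≤
1, and the bound 1/3 of the monotone branch becomes 4/3. The Poincaré inequalities become e ≤ x and
x ≤ d². -/
lemma IsImplicitEuler.gradSq_le_small (hc : IsDomainConstants c₀ c₄ c₅) (hν : 0 < ν) (hk : 0 < k)
    (hu₀ : IsSolH1 u₀) (hf : IsForcing f) (hfn : IsDiscreteForcing f fn)
    (H : IsImplicitEuler ν k fn u₀ u)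
    (hsmall : gradSq u₀ + 2 * c₀ / ν ^ 2 * supL2 f ^ 2 ≤ ν ^ 2 / (2 * Real.sqrt (c₀ * c₄)))
    (hkc : k ≤ c₀ / ν) (hK : StepRestriction c₀ c₄ c₅ ν k u₀ f (K1t c₀ ν u₀ f)) (n : ℕ) :
    gradSq (u n) ≤ K1t c₀ ν u₀ f := by
  have h0 := hc.pos₀
  have h4 := hc.pos₄
  set F := supL2 f with hF
  have hF0 : 0 ≤ F := supL2_nonneg f
  set S := ν ^ 2 / (2 * Real.sqrt (c₀ * c₄)) with hS
  have hsq : Real.sqrt (c₀ * c₄) ^ 2 = c₀ * c₄ := Real.sq_sqrt (by positivity)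
  have hsq0 : 0 < Real.sqrt (c₀ * c₄) := Real.sqrt_pos.2 (by positivity)
  have hS0 : 0 < S := by positivity
  have hS2 : c₄ / ν ^ 3 * S ^ 2 = ν / (4 * c₀) := by
    rw [hS, div_pow, mul_pow, hsq]
    field_simp; norm_num
  set h := ν * k / c₀ with hh
  have hh0 : 0 < h := by positivity
  have hh1 : h ≤ 1 := by
    rw [hh, div_le_one h0]
    rw [le_div_iff₀ hν] at hkc
    linarith
  set r := Real.sqrt (c₀ / S) * F / ν with hr
  have hr0 : 0 ≤ r := by positivity
  have hr2 : r ^ 2 = c₀ / ν ^ 2 * F ^ 2 / S := by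
    rw [hr, div_pow, mul_pow, Real.sq_sqrt (by positivity)]
    ring
  have hK1 : K1t c₀ ν u₀ f = S * (gradSq u₀ / S + 10 * r ^ 2) := by
    rw [hr2, K1t, ← hF]; field_simp
  have hx0 : gradSq (u 0) / S = gradSq u₀ / S := by rw [H.init]
  have key := global_bound (x := fun m => gradSq (u m) / S) (e := fun m => l2Sq (u m) / (c₀ * S))
    (r := r) (h := h) hr0 hh0 hh1 (fun m => div_nonneg (gradSq_nonneg _) hS0.le)
    (fun m => ?_) (fun m => div_nonneg (l2Sq_nonneg _) (by positivity)) ?_ (fun m => ?_)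
    (fun m => ?_) (fun m hm => ?_) n
  · simp only [hx0] at key
    rw [div_le_iff₀ hS0] at key
    rw [hK1]
    linarith
  · have := hc.poincare _ (H.isSolH1 hu₀ m).reg (H.isSolH1 hu₀ m).mean
    rw [div_le_div_iff₀ (by positivity) hS0]
    nlinarith
  · simp only [hx0]
    rw [hr2]
    have e : gradSq u₀ / S + 2 * (c₀ / ν ^ 2 * F ^ 2 / S)
        = (gradSq u₀ + 2 * c₀ / ν ^ 2 * F ^ 2) / S := by ring
    rw [e, div_le_one hS0]
    exact hsmall
  · obtain ⟨D, hD0, hDa, hD⟩ := (H.step_estimates hc hν hk hu₀ hfn m).1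
    refine ⟨Real.sqrt (c₀ / S) * Real.sqrt D, by positivity, ?_, ?_⟩
    · rw [mul_pow, Real.sq_sqrt (by positivity), Real.sq_sqrt hD0, div_mul_eq_mul_div]
      exact div_le_div_of_nonneg_right hDa hS0.le
    · rw [← sub_div, div_le_iff₀ hS0]
      refine hD.trans (le_of_eq ?_)
      set a := gradSq (u (m + 1))
      have hcs : Real.sqrt (c₀ / S) ^ 2 = c₀ / S := Real.sq_sqrt (by positivity)
      have e1 : h * ((a / S) ^ 3 / 4 - (Real.sqrt (c₀ / S) * Real.sqrt D) ^ 2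
          + 2 * r * (Real.sqrt (c₀ / S) * Real.sqrt D)) * S
          = h * ((a / S) ^ 3 / 4 - c₀ / S * D + 2 * (F / ν) * (c₀ / S) * Real.sqrt D) * S := by
        rw [mul_pow, hcs, Real.sq_sqrt hD0, hr]
        linear_combination (h * 2 * (F / ν) * Real.sqrt D * S) * hcs
      have e2 : h * ((a / S) ^ 3 / 4) * S = k * (c₄ / ν ^ 3 * a ^ 3) := by
        have : h / 4 = k * (c₄ / ν ^ 3 * S ^ 2) := by rw [hS2, hh]; field_simp
        calc h * ((a / S) ^ 3 / 4) * S = h / 4 * (a / S) ^ 3 * S := by ring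
          _ = k * (c₄ / ν ^ 3 * a ^ 3) := by rw [this]; field_simp
      rw [e1]
      have e3 : h * (c₀ / S * D) * S = k * (ν * D) := by rw [hh]; field_simp
      have e4 : h * (2 * (F / ν) * (c₀ / S) * Real.sqrt D) * S = k * (2 * F * Real.sqrt D) := by
        rw [hh]; field_simp
      linear_combination -e2 + e3 - e4
  · have hs := (H.step_estimates hc hν hk hu₀ hfn m).2.1
    -- Bounding the H⁻¹ force by √c₀ F lets both scaled inequalities share the same r.
    have hFm := supHm1_le h0.le hc.poincare hf
    rw [← sub_div, div_le_iff₀ (by positivity)]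
    set a := gradSq (u (m + 1))
    have hFa : supHm1 f * Real.sqrt a ≤ Real.sqrt c₀ * F * Real.sqrt a :=
      mul_le_mul_of_nonneg_right hFm (Real.sqrt_nonneg _)
    refine hs.trans ((mul_le_mul_of_nonneg_left
      (by linarith : _ ≤ -2 * ν * a + 2 * (Real.sqrt c₀ * F * Real.sqrt a)) hk.le).trans
      (le_of_eq ?_))
    have hs0 : 0 < Real.sqrt S := Real.sqrt_pos.2 hS0
    have hsS := Real.sq_sqrt hS0.le
    have hsc := Real.sq_sqrt h0.le
    rw [hr, Real.sqrt_div h0.le, Real.sqrt_div (gradSq_nonneg _), hh]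
    have e1 : Real.sqrt c₀ / Real.sqrt S * F / ν * (Real.sqrt a / Real.sqrt S)
        = Real.sqrt c₀ * F * Real.sqrt a / (ν * S) := by
      have : Real.sqrt c₀ / Real.sqrt S * F / ν * (Real.sqrt a / Real.sqrt S)
          = Real.sqrt c₀ * F * Real.sqrt a / (ν * Real.sqrt S ^ 2) := by field_simp
      rw [this, hsS]
    have e2 : ν * k / c₀ * (-2 * (a / S) + 2 * (Real.sqrt c₀ / Real.sqrt S * F / ν)
        * (Real.sqrt a / Real.sqrt S)) = ν * k / c₀ * (-2 * (a / S)
          + 2 * (Real.sqrt c₀ * F * Real.sqrt a / (ν * S))) := by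
      rw [← e1]; ring
    rw [e2]
    field_simp
  · simp only [hx0] at hm
    have hm' : gradSq (u m) ≤ K1t c₀ ν u₀ f := by
      rw [div_le_iff₀ hS0] at hm
      rw [hK1]; linarith
    have hst := H.mul_gradSq_sq_le hc hν hk hu₀ hfn hK hm'
    have e : h * (gradSq (u (m + 1)) / S) ^ 2
        = 4 * (c₄ / ν ^ 3 * k * gradSq (u (m + 1)) ^ 2) := by
      have : h = 4 * k * (c₄ / ν ^ 3 * S ^ 2) := by rw [hS2, hh]; field_simp
      rw [this]; field_simp
    rw [e]
    linarith

end Scheme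

end

end EulerNSE

/-! ### The main theorem -/

theorem theorem2 :
    (∃ c₀ c₄ c₅ : ℝ, EulerNSE.IsDomainConstants c₀ c₄ c₅) ∧
    ∀ c₀ c₄ c₅ : ℝ, EulerNSE.IsDomainConstants c₀ c₄ c₅ →
    ∀ ν : ℝ, 0 < ν →
    ∀ u₀ : EulerNSE.Field, EulerNSE.IsSolH1 u₀ →
    ∀ f : ℝ → EulerNSE.Field, EulerNSE.IsForcing f →
      -- short times
      (∃ tf : ℝ, 0 < tf ∧
        ν ^ 3 / (8 * c₄ * (EulerNSE.gradSq u₀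
          + (2 * ν ^ 2 * EulerNSE.supL2 f ^ 2 / c₄) ^ (1 / 3 : ℝ)) ^ 2) ≤ tf ∧
        ∀ k : ℝ, 0 < k →
          EulerNSE.StepRestriction c₀ c₄ c₅ ν k u₀ f (EulerNSE.Kt c₀ c₄ ν u₀ f) →
          (2 * EulerNSE.gradSq u₀
            + (1 + (2 : ℝ) ^ (1 / 3 : ℝ)) * ν ^ (2 / 3 : ℝ) * EulerNSE.supL2 f ^ (2 / 3 : ℝ)
              / c₄ ^ (1 / 3 : ℝ)) ^ 2
            ≤ ((2 : ℝ) ^ (1 / 3 : ℝ) - 1) * ν ^ 3 / (2 * c₄ * k) →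
          ∀ fn : ℕ → EulerNSE.Field, EulerNSE.IsDiscreteForcing f fn →
          ∀ u : ℕ → EulerNSE.Field, EulerNSE.IsImplicitEuler ν k fn u₀ u →
          ∀ n : ℕ, n * k ≤ tf →
            EulerNSE.gradSq (u n) ≤ 2 * EulerNSE.gradSq u₀
              + (ν ^ 2 * EulerNSE.supL2 f ^ 2 / c₄) ^ (1 / 3 : ℝ)) ∧
      -- small solutions
      (EulerNSE.gradSq u₀ + 2 * c₀ / ν ^ 2 * EulerNSE.supL2 f ^ 2
          ≤ ν ^ 2 / (2 * Real.sqrt (c₀ * c₄)) →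
        ∀ k : ℝ, 0 < k → k ≤ c₀ / ν →
          EulerNSE.StepRestriction c₀ c₄ c₅ ν k u₀ f (EulerNSE.K1t c₀ ν u₀ f) →
          ∀ fn : ℕ → EulerNSE.Field, EulerNSE.IsDiscreteForcing f fn →
          ∀ u : ℕ → EulerNSE.Field, EulerNSE.IsImplicitEuler ν k fn u₀ u →
          ∀ n : ℕ, EulerNSE.gradSq (u n) ≤ EulerNSE.K1t c₀ ν u₀ f) := by

  refine ⟨EulerNSE.exists_isDomainConstants, fun c₀ c₄ c₅ hc ν hν u₀ hu₀ f hf => ⟨?_, ?_⟩⟩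
  · have h4 := hc.pos₄
    set Q := EulerNSE.gradSq u₀ + (2 * ν ^ 2 * EulerNSE.supL2 f ^ 2 / c₄) ^ (1 / 3 : ℝ)
    rcases eq_or_ne Q 0 with hQ | hQ
    -- If the denominator vanishes, its quotient is 0 by convention and the time condition holds for
    -- every n; the value 1 is arbitrary. Otherwise the lower bound itself serves as the time.
    · refine ⟨1, one_pos, by simp [hQ], ?_⟩
      intro k hk hK _ fn hfn u H n _
      exact H.gradSq_le_short hc hν hk hu₀ hfn hK (by simp [Q] at hQ ⊢; simp [hQ])
    · have hQ2 : 0 < Q ^ 2 := by positivity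
      refine ⟨_, by positivity, le_rfl, ?_⟩
      intro k hk hK _ fn hfn u H n hn
      refine H.gradSq_le_short hc hν hk hu₀ hfn hK ?_
      rw [le_div_iff₀ (by positivity)] at hn
      rw [div_mul_eq_mul_div, div_mul_eq_mul_div, div_le_one (by positivity)]
      linarith
  · intro hsmall k hk hkc hK fn hfn u H n
    exact H.gradSq_le_small hc hν hk hu₀ hf hfn hsmall hkc hK n
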